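/- Work over $\mathbb{C}$. Let $r\ge 1$, and let $\boldsymbol n=(n_1,\dots,n_r)$ and $\boldsymbol d=(d_1,\dots,d_r)$ be $r$-tuples of positive integers with $n_1\le\dots\le n_r$; put $d=d_1+\dots+d_r$. Let $X=SV^{\boldsymbol n}_{\boldsymbol d}\subset\mathbb{P}^N$, $N=\prod_{i}\binom{n_i+d_i}{n_i}-1$, be the Segre–Veronese variety, that is, the image of $\mathbb{P}^{n_1}\times\dots\times\mathbb{P}^{n_r}$ under the embedding given by the complete linear system of $\mathcal{O}(d_1,\dots,d_r)$. For a smooth point $p$ of a projective variety $Y\subset\mathbb{P}^M$ and $m\ge 0$, let $T^m_p=T^m_pY\subset\mathbb{P}^M$ be the $m$-osculating space: the linear subspace on which all those linear forms vanish whose restriction to $Y$ lies in $\mathfrak{m}_p^{m+1}\mathcal{O}_Y(1)_p$ (equivalently, the span of the partial derivatives of order at most $m$ at $p$ of a local parametrization of $Y$). All curves $C$ below are smooth and irreducible, with two marked points $t_0,t_\infty\in C$, and flat limits are limits in the Grassmannian as $t\to t_0$. * $Y$ has *strong $2$-osculating regularity* if for general points $p,q\in Y$ and all integers $k_1,k_2\ge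 0$ there are a curve $C$ and a morphism $\gamma:C\to Y$ with $\gamma(t_0)=p$, $\gamma(t_\infty)=q$, such that the flat limit at $t_0$ of the family $\langle T^{k_1}_p,T^{k_2}_{\gamma(t)}\rangle$, $t\in C\setminus\{t_0\}$, is contained in $T^{k_1+k_2+1}_p$. * $Y$ has *$m$-osculating regularity* ($m\ge 1$) if for general points $p_1,\dots,p_m\in Y$ and every integer $k\ge 0$ there are a curve $C$ and morphisms $\gamma_j:C\to Y$, $j=2,\dots,m$, with $\gamma_j(t_0)=p_1$, $\gamma_j(t_\infty)=p_j$, such that the flat limit at $t_0$ of the family $\langle T^k_{p_1},T^k_{\gamma_2(t)},\dots,T^k_{\gamma_m(t)}\rangle$, $t\in C\setminus\{t_0\}$, is contained in $T^{2k+1}_{p_1}$. Then $X$ has strong $2$-osculating regularity and $(n_1+1)$-osculating regularity. Moreover, in both cases, for general points of $X$, the curve $C$ and the morphisms $\gamma$ (respectively $\gamma_j$) can be chosen independently of $k_1,k_2$ (respectively $k$), and so that each of these morphisms is injective with image contained in a rational normal curve of degree $d$ lying on $X$. -/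

import Mathlib

namespace OscReg

open MvPolynomial

/-! Points of the projective space over `ℂ` with homogeneous coordinates indexed by a finite
type `ι` are elements of `Projectivization ℂ (ι → ℂ)`; its linear subspaces are given by the
corresponding `ℂ`-subspaces of `ι → ℂ`. -/

/-- `v` is a vector of homogeneous coordinates of the point `p`. -/
def Represents {ι : Type} (v : ι → ℂ) (p : Projectivization ℂ (ι → ℂ)) : Prop :=
  ∃ h : v ≠ 0, Projectivization.mk ℂ v h = p

/-- The punctured affine cone over a subset of projective space. -/
def cone {ι : Type} (X : Set (Projectivization ℂ (ι → ℂ))) : Set (ι → ℂ) :=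
  {v | ∃ p ∈ X, Represents v p}

/-- The homogeneous ideal of a subset of projective space. -/
noncomputable def projIdeal {ι : Type} (X : Set (Projectivization ℂ (ι → ℂ))) :
    Ideal (MvPolynomial ι ℂ) :=
  vanishingIdeal ℂ (cone X)

/-- The linear form `∑ aᵢ xᵢ`. -/
noncomputable def linForm {ι : Type} [Fintype ι] (a : ι → ℂ) : MvPolynomial ι ℂ :=
  ∑ i, C (a i) * X i

/-- The restriction of the linear form `∑ aᵢ xᵢ` (a section of `𝒪(1)`) to the variety `V`
vanishes to order at least `s` at `p ∈ V`, that is, it lies in `𝔪 ^ s` times the stalk of `𝒪(1)`,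
where `𝔪` is the maximal ideal of the local ring of `V` at `p`.
This local ring is obtained from `ℂ[x] / I(V)` by localizing at the homogeneous prime `I(p)`. -/
def VanishesToOrder {ι : Type} [Fintype ι] (V : Set (Projectivization ℂ (ι → ℂ)))
    (p : Projectivization ℂ (ι → ℂ)) (s : ℕ) (a : ι → ℂ) : Prop :=
  ∃ G : MvPolynomial ι ℂ, G ∉ projIdeal {p} ∧
    G * linForm a ∈ projIdeal V ⊔ projIdeal {p} ^ s

/-- The `m`-osculating space `T^m_p V`: the linear space dual to the image of the linear forms in
`H⁰(V, 𝒪(1) ⊗ 𝒪_V / 𝔪_p ^ (m + 1))`, i.e. the common zeros of all linear forms whose restriction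
to `V` vanishes at `p` together with all its derivatives of order at most `m`. -/
def osculatingSpace {ι : Type} [Fintype ι] (V : Set (Projectivization ℂ (ι → ℂ))) (m : ℕ)
    (p : Projectivization ℂ (ι → ℂ)) : Submodule ℂ (ι → ℂ) where
  carrier := {w | ∀ a : ι → ℂ, VanishesToOrder V p (m + 1) a → ∑ i, a i * w i = 0}
  zero_mem' := by intro a _; simp
  add_mem' := by
    intro w w' hw hw' a ha
    simp [mul_add, Finset.sum_add_distrib, hw a ha, hw' a ha]
  smul_mem' := by
    intro c w hw a ha
    have h := hw a ha
    simp only [Pi.smul_apply, smul_eq_mul, mul_left_comm _ c, ← Finset.mul_sum, h, mul_zero]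

/-- A smooth irreducible affine curve over `ℂ`, given by its coordinate ring. (A smooth irreducible
curve becomes affine after removing a point, so when only finitely many points of the curve and a
neighbourhood of one of them matter, nothing is lost by restricting to affine curves.) -/
structure SmoothCurve where
  coordRing : Type
  [commRing : CommRing coordRing]
  [isDomain : IsDomain coordRing]
  [algebra : Algebra ℂ coordRing]
  [smooth : Algebra.Smooth ℂ coordRing]
  dim_eq_one : ringKrullDim coordRing = 1

attribute [instance] SmoothCurve.commRing SmoothCurve.isDomain SmoothCurve.algebra
  SmoothCurve.smooth

/-- The closed points of the curve; the value at `t` of a regular function `f` is `t f`. -/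
abbrev SmoothCurve.Point (C : SmoothCurve) : Type := C.coordRing →ₐ[ℂ] ℂ

/-- `γ` is a morphism from the curve to projective space: locally it is given by regular functions
without common zeros. -/
def IsMorphism {ι : Type} (C : SmoothCurve) (γ : C.Point → Projectivization ℂ (ι → ℂ)) : Prop :=
  ∀ t : C.Point, ∃ f : ι → C.coordRing, (fun i => t (f i)) ≠ 0 ∧
    ∀ t' : C.Point, (fun i => t' (f i)) ≠ 0 → Represents (fun i => t' (f i)) (γ t')

/-- `T₀` is the flat limit at `t₀` of the family of linear spaces `T t`, `t ≠ t₀`: on a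
neighbourhood `h ≠ 0` of `t₀` there is a morphism to a Grassmannian, given by a frame `f` of
regular vector-valued functions, whose value at `t` is `T t` for `t ≠ t₀`, and is `T₀` for
`t = t₀`. -/
def IsFlatLimit {ι : Type} (C : SmoothCurve) (t₀ : C.Point)
    (T : C.Point → Submodule ℂ (ι → ℂ)) (T₀ : Submodule ℂ (ι → ℂ)) : Prop :=
  ∃ (m : ℕ) (f : Fin m → ι → C.coordRing) (h : C.coordRing), t₀ h ≠ 0 ∧
    (∀ t : C.Point, t h ≠ 0 → LinearIndependent ℂ (fun j i => t (f j i))) ∧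
    (∀ t : C.Point, t h ≠ 0 → t ≠ t₀ →
      T t = Submodule.span ℂ (Set.range fun j i => t (f j i))) ∧
    T₀ = Submodule.span ℂ (Set.range fun j i => t₀ (f j i))

/-- The property `P` holds for general points `p₀, …, p_{m-1}` of the irreducible variety `V`:
it holds on a nonempty basic Zariski open subset of `V × ⋯ × V`, the locus where some polynomial
`F` in the `m` sets of homogeneous coordinates is nonzero. -/
def ForGeneralPoints {ι : Type} (V : Set (Projectivization ℂ (ι → ℂ))) (m : ℕ)
    (P : (Fin m → Projectivization ℂ (ι → ℂ)) → Prop) : Prop :=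
  ∃ F : MvPolynomial (Fin m × ι) ℂ,
    (∃ v : Fin m → ι → ℂ, (∀ j, v j ∈ cone V) ∧ eval (fun x => v x.1 x.2) F ≠ 0) ∧
    ∀ (p : Fin m → Projectivization ℂ (ι → ℂ)) (v : Fin m → ι → ℂ),
      (∀ j, p j ∈ V) → (∀ j, Represents (v j) (p j)) → eval (fun x => v x.1 x.2) F ≠ 0 → P p

/-- The flat limit at `t₀` of the spans `⟨T^{k₁}_p, T^{k₂}_{γ(t)}⟩` is contained in
`T^{k₁ + k₂ + 1}_p`. -/
def PairLimitContained {ι : Type} [Fintype ι] (V : Set (Projectivization ℂ (ι → ℂ)))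
    (p : Projectivization ℂ (ι → ℂ)) (C : SmoothCurve) (t₀ : C.Point)
    (γ : C.Point → Projectivization ℂ (ι → ℂ)) (k₁ k₂ : ℕ) : Prop :=
  ∃ T₀ : Submodule ℂ (ι → ℂ),
    IsFlatLimit C t₀ (fun t => osculatingSpace V k₁ p ⊔ osculatingSpace V k₂ (γ t)) T₀ ∧
    T₀ ≤ osculatingSpace V (k₁ + k₂ + 1) p

/-- The flat limit at `t₀` of the spans of `T^k_p` and all `T^k_{γⱼ(t)}`, `j ≠ 0`, is contained in
`T^{2k + 1}_p`. -/
def MultiLimitContained {ι : Type} [Fintype ι] (V : Set (Projectivization ℂ (ι → ℂ)))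
    {m : ℕ} [NeZero m] (p : Projectivization ℂ (ι → ℂ)) (C : SmoothCurve) (t₀ : C.Point)
    (γ : Fin m → C.Point → Projectivization ℂ (ι → ℂ)) (k : ℕ) : Prop :=
  ∃ T₀ : Submodule ℂ (ι → ℂ),
    IsFlatLimit C t₀
      (fun t => osculatingSpace V k p ⊔ ⨆ (j : Fin m) (_ : j ≠ 0), osculatingSpace V k (γ j t)) T₀ ∧
    T₀ ≤ osculatingSpace V (2 * k + 1) p

/-- Strong `2`-osculating regularity. -/
def HasStrongTwoOsculatingRegularity {ι : Type} [Fintype ι]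
    (V : Set (Projectivization ℂ (ι → ℂ))) : Prop :=
  ForGeneralPoints V 2 fun p => ∀ k₁ k₂ : ℕ,
    ∃ (C : SmoothCurve) (t₀ tinf : C.Point) (γ : C.Point → Projectivization ℂ (ι → ℂ)),
      IsMorphism C γ ∧ (∀ t, γ t ∈ V) ∧ γ t₀ = p 0 ∧ γ tinf = p 1 ∧
      PairLimitContained V (p 0) C t₀ γ k₁ k₂

/-- `m`-osculating regularity (`m ≥ 1`); the `m` points are indexed from `0` to `m - 1`, and
`γ 0` plays no role. -/
def HasOsculatingRegularity {ι : Type} [Fintype ι]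
    (V : Set (Projectivization ℂ (ι → ℂ))) (m : ℕ) [NeZero m] : Prop :=
  ForGeneralPoints V m fun p => ∀ k : ℕ,
    ∃ (C : SmoothCurve) (t₀ tinf : C.Point) (γ : Fin m → C.Point → Projectivization ℂ (ι → ℂ)),
      (∀ j, j ≠ 0 →
        IsMorphism C (γ j) ∧ (∀ t, γ j t ∈ V) ∧ γ j t₀ = p 0 ∧ γ j tinf = p j) ∧
      MultiLimitContained V (p 0) C t₀ γ k

/-- `R` is a rational normal curve of degree `d` (in its linear span): the image of
`[s : t] ↦ [s ^ d : s ^ (d - 1) t : ⋯ : t ^ d]` under an injective linear map. -/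
def IsRationalNormalCurve {ι : Type} (d : ℕ) (R : Set (Projectivization ℂ (ι → ℂ))) : Prop :=
  ∃ L : (Fin (d + 1) → ℂ) →ₗ[ℂ] (ι → ℂ), Function.Injective L ∧
    R = {p | ∃ s t : ℂ, (s ≠ 0 ∨ t ≠ 0) ∧
      Represents (L fun a => s ^ (d - (a : ℕ)) * t ^ (a : ℕ)) p}

/-- The index set of the homogeneous coordinates: an index `J` consists, for every `i`, of a
multiset `J i` of `d i` elements of `{0, …, n i}`, i.e. a monomial of degree `d i` in `n i + 1`
variables. -/
abbrev SVIndex {r : ℕ} (n d : Fin r → ℕ) : Type :=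
  (i : Fin r) → Sym (Fin (n i + 1)) (d i)

/-- All monomials of multidegree `d` in the coordinates of `(v₁, …, v_r)`. In characteristic zero
these are, up to nonzero constant factors depending only on `J`, the coordinates of
`v₁ ^ d₁ ⊗ ⋯ ⊗ v_r ^ d_r` in the monomial basis of `Sym^{d₁} ⊗ ⋯ ⊗ Sym^{d_r}`. -/
def svVec {r : ℕ} (n d : Fin r → ℕ) (v : (i : Fin r) → Fin (n i + 1) → ℂ) : SVIndex n d → ℂ :=
  fun J => ∏ i, ((J i : Multiset (Fin (n i + 1))).map (v i)).prod

/-- The Segre-Veronese variety: the image of `ℙ^{n₁} × ⋯ × ℙ^{n_r}` under the embedding given by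
the complete linear system of `𝒪(d₁, …, d_r)`. -/
def segreVeronese {r : ℕ} (n d : Fin r → ℕ) : Set (Projectivization ℂ (SVIndex n d → ℂ)) :=
  {p | ∃ v : (i : Fin r) → Fin (n i + 1) → ℂ, (∀ i, v i ≠ 0) ∧ Represents (svVec n d v) p}

end OscReg

/-! The proof is dual: a limit of the spans lies in `T^{k₁+k₂+1}_p` as soon as every linear form `a`
vanishing to order `k₁+k₂+2` at `p` is the value at `s = 0` of a polynomial family `A_s` of forms
vanishing to order `k₁+1` at `p` and to order `k₂+1` at every moving point.

General points have linearly independent components in every factor, so in each factor there are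
linear coordinates in which these components are distinct basis vectors; let `x_o` be the coordinate
dual to the component of `p`, and `x_{σ j}` the one dual to the component of `p_j`. The moving point
is `(1-s) p + s p_j` in each factor. By `VanishesAlongLines.exists_formSum`, the form `a` is a
combination of monomials with at least `k₁+k₂+2` factors other than `x_o`. All these factors vanish
at `p`, and `x_c` with `c ≠ o, σ j` also vanishes along the `j`-th line. The factor `x_{σ j}` does
not, but its deformation `(1-s) x_{σ j} - s x_o` does, at the cost of no longer vanishing at `p` for
`s ≠ 0`. Deciding which factors to deform is a counting problem, solved in `exists_balancing_set`;
`exists_moving_form` assembles the family.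

Two translations support this. `osculatingSpace_eq_span` replaces the local-ring definition by
Taylor coefficients along lines, and `exists_isFlatLimit` builds the limit from a saturated
submodule over `ℂ[X]`. The curves are rational normal because their coordinates are binary forms of
degree `∑ i, d i` (`momentMap_injective`). -/

namespace OscReg

/-! ### Segre–Veronese coordinates and products of linear forms. -/

section Coordinates

variable {r : ℕ} {n d : Fin r → ℕ}

/-- The coordinates of the Segre-Veronese embedding over an arbitrary commutative ring. -/
def svCoord {R : Type*} [CommRing R] (n d : Fin r → ℕ) (u : (i : Fin r) → Fin (n i + 1) → R) :
    SVIndex n d → R :=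
  fun J => ∏ i, ((J i : Multiset (Fin (n i + 1))).map (u i)).prod

/-- An ordered choice of `d i` indices for every factor `i`. -/
abbrev OrdIndex (n d : Fin r → ℕ) : Type := (i : Fin r) → Fin (d i) → Fin (n i + 1)

/-- The unordered multi-index underlying an ordered one. -/
def OrdIndex.toSV (f : OrdIndex n d) : SVIndex n d :=
  fun i => ⟨Finset.univ.val.map (f i), by simp⟩

theorem OrdIndex.toSV_surjective : Function.Surjective (OrdIndex.toSV (n := n) (d := d)) := by
  intro J
  have h : ∀ i, ∃ g : Fin (d i) → Fin (n i + 1),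
      Finset.univ.val.map g = (J i : Multiset (Fin (n i + 1))) := by
    intro i
    obtain ⟨l, hl⟩ := Quot.exists_rep (J i : Multiset (Fin (n i + 1)))
    have hc : l.length = d i := by
      have := (J i).2
      rw [← Multiset.coe_card]
      exact (congrArg Multiset.card hl).trans this
    refine ⟨fun k => l.get (k.cast hc.symm), ?_⟩
    rw [← hl]
    have : (fun k : Fin (d i) => l.get (k.cast hc.symm)) = l.get ∘ Fin.cast hc.symm := rfl
    rw [Fin.univ_val_map]
    refine congrArg _ ?_
    apply List.ext_get
    · simp [hc]
    · intro k h1 h2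
      simp
  choose g hg using h
  exact ⟨g, funext fun i => Subtype.ext (hg i)⟩

/-- An ordered representative of a multi-index. -/
noncomputable def rep (J : SVIndex n d) : OrdIndex n d := (OrdIndex.toSV_surjective J).choose

@[simp] theorem toSV_rep (J : SVIndex n d) : (rep J).toSV = J :=
  (OrdIndex.toSV_surjective J).choose_spec

variable {R : Type*} [CommRing R] {R' : Type*} [CommRing R']

theorem svVec_eq_svCoord (v : (i : Fin r) → Fin (n i + 1) → ℂ) : svVec n d v = svCoord n d v := rfl

theorem svCoord_toSV (u : (i : Fin r) → Fin (n i + 1) → R) (f : OrdIndex n d) :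
    svCoord n d u f.toSV = ∏ i, ∏ k, u i (f i k) := by
  simp [svCoord, OrdIndex.toSV, Finset.prod, Function.comp_def]

theorem svCoord_eq (u : (i : Fin r) → Fin (n i + 1) → R) (J : SVIndex n d) :
    svCoord n d u J = ∏ i, ∏ k, u i (rep J i k) := by
  rw [← svCoord_toSV, toSV_rep]

theorem map_svCoord (φ : R →+* R') (u : (i : Fin r) → Fin (n i + 1) → R) (J : SVIndex n d) :
    φ (svCoord n d u J) = svCoord n d (fun i c => φ (u i c)) J := by
  simp [svCoord_eq, map_prod]

theorem svCoord_smul (c : Fin r → R) (u : (i : Fin r) → Fin (n i + 1) → R) (J : SVIndex n d) :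
    svCoord n d (fun i => c i • u i) J = (∏ i, c i ^ d i) * svCoord n d u J := by
  simp [svCoord_eq, Finset.prod_mul_distrib]

open Classical in
/-- The coefficients, with respect to the coordinates of the Segre-Veronese embedding, of the
product of the linear forms `l i k` in the `i`-th group of variables. -/
noncomputable def prodForm (l : (i : Fin r) → Fin (d i) → Fin (n i + 1) → R) : SVIndex n d → R :=
  fun J => ∑ f : OrdIndex n d, if f.toSV = J then ∏ i, ∏ k, l i k (f i k) else 0

/-- Expanding the product of sums gives one term per ordered index; `prodForm` groups these terms by
the underlying multi-index. -/
theorem prodForm_dot (l : (i : Fin r) → Fin (d i) → Fin (n i + 1) → R)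
    (u : (i : Fin r) → Fin (n i + 1) → R) :
    ∑ J, prodForm l J * svCoord n d u J = ∏ i, ∏ k, l i k ⬝ᵥ u i := by
  classical
  have h : ∀ i, ∏ k, l i k ⬝ᵥ u i
      = ∑ g : Fin (d i) → Fin (n i + 1), ∏ k, l i k (g k) * u i (g k) := fun i => by
    simp only [dotProduct]
    rw [Fintype.prod_sum]
  simp_rw [h]
  rw [Fintype.prod_sum]
  simp only [prodForm, Finset.sum_mul]
  rw [Finset.sum_comm]
  refine Finset.sum_congr rfl fun f _ => ?_
  simp only [ite_mul, zero_mul, Finset.sum_ite_eq, Finset.mem_univ, if_true, svCoord_toSV,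
    Finset.prod_mul_distrib]

theorem map_prodForm (φ : R →+* R') (l : (i : Fin r) → Fin (d i) → Fin (n i + 1) → R)
    (J : SVIndex n d) :
    φ (prodForm l J) = prodForm (fun i k c => φ (l i k c)) J := by
  simp only [prodForm, map_sum, apply_ite φ, map_prod, map_zero]

/-- The exponent vector of a multi-index. -/
noncomputable def expo (J : SVIndex n d) : (Σ i, Fin (n i + 1)) →₀ ℕ :=
  Finsupp.equivFunOnFinite.symm fun x => (J x.1 : Multiset (Fin (n x.1 + 1))).count x.2

theorem expo_injective : Function.Injective (expo (n := n) (d := d)) := by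
  intro J K h
  funext i
  apply Subtype.ext
  ext c
  exact DFunLike.congr_fun h ⟨i, c⟩

theorem svCoord_X (J : SVIndex n d) :
    svCoord n d (fun i c => (MvPolynomial.X ⟨i, c⟩ : MvPolynomial (Σ i, Fin (n i + 1)) ℂ)) J
      = MvPolynomial.monomial (expo J) 1 := by
  rw [MvPolynomial.monomial_eq, Finsupp.prod_fintype _ _ (fun _ => pow_zero _),
    Fintype.prod_sigma]
  simp only [map_one, one_mul, svCoord]
  refine Finset.prod_congr rfl fun i _ => ?_
  rw [Finset.prod_multiset_map_count]
  refine Finset.prod_subset (Finset.subset_univ _) fun c _ hc => ?_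
  rw [Multiset.count_eq_zero_of_notMem (by simpa using hc), pow_zero]

/-- Linear forms that vanish on an open subset of the Segre-Veronese variety are zero. -/
theorem eq_zero_of_dot_svCoord (o : (i : Fin r) → Fin (n i + 1)) (b : SVIndex n d → ℂ)
    (h : ∀ w : (i : Fin r) → Fin (n i + 1) → ℂ, (∀ i, w i (o i) ≠ 0) →
      ∑ J, b J * svCoord n d w J = 0) : b = 0 := by
  classical
  -- The extra factor kills the locus where some `w i (o i)` is zero, so the product vanishes
  -- everywhere; it is then cancelled in a domain.
  have hQ : (∏ i, MvPolynomial.X ⟨i, o i⟩ : MvPolynomial (Σ i, Fin (n i + 1)) ℂ) *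
      ∑ J, MvPolynomial.C (b J) * svCoord n d (fun i c => MvPolynomial.X ⟨i, c⟩) J = 0 := by
    apply MvPolynomial.funext
    intro w
    by_cases hw : ∀ i, w ⟨i, o i⟩ ≠ 0
    · have := h (fun i c => w ⟨i, c⟩) hw
      simp [map_svCoord, this]
    · push Not at hw
      obtain ⟨i, hi⟩ := hw
      have : ∏ i, w ⟨i, o i⟩ = 0 := Finset.prod_eq_zero (Finset.mem_univ i) hi
      simp [this]
  rcases mul_eq_zero.1 hQ with h0 | h0
  · rw [Finset.prod_eq_zero_iff] at h0
    obtain ⟨i, _, hi⟩ := h0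
    exact absurd hi (MvPolynomial.X_ne_zero _)
  · funext K
    have := congrArg (MvPolynomial.coeff (expo K)) h0
    simpa [svCoord_X, MvPolynomial.coeff_sum, MvPolynomial.coeff_C_mul,
      MvPolynomial.coeff_monomial, expo_injective.eq_iff] using this

end Coordinates

/-! ### Linear coordinates adapted to independent vectors. -/

section Frames

/-- For linearly independent vectors `v j` in `ℂ ^ N` there are linear coordinates `x c` on
`ℂ ^ N` in which the `v j` are distinct standard basis vectors. -/
theorem exists_dual_coordinates {m N : ℕ} {v : Fin m → Fin N → ℂ} (hv : LinearIndependent ℂ v) :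
    ∃ (σ : Fin m → Fin N) (x : Fin N → Fin N → ℂ), Function.Injective σ ∧
      (∀ c j, x c ⬝ᵥ v j = if c = σ j then 1 else 0) ∧
      Function.Surjective (fun (u : Fin N → ℂ) c => x c ⬝ᵥ u) := by
  classical
  -- The `x c` are the coordinate functionals of a basis extending `v`, reindexed by `Fin N`.
  let b := Module.Basis.sumExtend hv
  have : Finite (Fin m ⊕ Module.Basis.sumExtendIndex hv) := Module.Finite.finite_basis b
  have := Fintype.ofFinite (Fin m ⊕ Module.Basis.sumExtendIndex hv)
  have hcard : Fintype.card (Fin m ⊕ Module.Basis.sumExtendIndex hv) = Fintype.card (Fin N) := by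
    rw [← Module.finrank_eq_card_basis b]; simp
  let e := Fintype.equivOfCardEq hcard
  let b' := b.reindex e
  have hdot : ∀ c (u : Fin N → ℂ), (fun k => b'.repr (Pi.single k 1) c) ⬝ᵥ u = b'.repr u c := by
    intro c u
    conv_rhs => rw [← (Pi.basisFun ℂ (Fin N)).sum_repr u]
    simp [dotProduct, map_sum, Finsupp.finsetSum_apply, mul_comm]
  have hb : ∀ j, b' (e (Sum.inl j)) = v j := by
    intro j
    simp only [b', b, Module.Basis.reindex_apply, Equiv.symm_apply_apply, Module.Basis.sumExtend, Module.Basis.coe_extend]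
    rfl
  refine ⟨fun j => e (Sum.inl j), fun c k => b'.repr (Pi.single k 1) c, ?_, ?_, ?_⟩
  · exact e.injective.comp Sum.inl_injective
  · intro c j
    rw [hdot, ← hb j, b'.repr_self, Finsupp.single_apply]
    simp [eq_comm]
  · intro w
    refine ⟨b'.equivFun.symm w, ?_⟩
    funext c
    simp only [hdot]
    rw [← b'.equivFun_apply, LinearEquiv.apply_symm_apply]

end Frames

/-! ### The affine line as parameter curve. -/

section AffineLine

/-- The affine line. -/
noncomputable def affineLine : SmoothCurve :=
  haveI : Algebra.Smooth ℂ (MvPolynomial Unit ℂ) := ⟨inferInstance, inferInstance⟩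
  haveI : Algebra.Smooth ℂ (Polynomial ℂ) :=
    Algebra.Smooth.of_equiv (MvPolynomial.uniqueAlgEquiv ℂ Unit)
  { coordRing := Polynomial ℂ
    dim_eq_one := by
      rw [Polynomial.ringKrullDim_of_isNoetherianRing, ringKrullDim_eq_zero_of_field, zero_add] }

/-- The point of the affine line with coordinate `s`. -/
noncomputable def linePoint (s : ℂ) : affineLine.Point :=
  (Polynomial.aeval s : Polynomial ℂ →ₐ[ℂ] ℂ)

/-- The coordinate of a point of the affine line. -/
noncomputable def lineCoord (t : affineLine.Point) : ℂ :=
  t (Polynomial.X : Polynomial ℂ)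

theorem point_apply (t : affineLine.Point) (f : Polynomial ℂ) :
    t f = Polynomial.eval (lineCoord t) f := by
  have h : ∀ φ : Polynomial ℂ →ₐ[ℂ] ℂ, φ f = Polynomial.eval (φ Polynomial.X) f := fun φ => by
    rw [← Polynomial.coe_aeval_eq_eval, Polynomial.aeval_algHom_apply, Polynomial.aeval_X_left,
      AlgHom.id_apply]
  exact h t

@[simp] theorem lineCoord_linePoint (s : ℂ) : lineCoord (linePoint s) = s :=
  Polynomial.aeval_X s

theorem lineCoord_injective : Function.Injective lineCoord := by
  intro t t' h
  apply DFunLike.ext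
  intro f
  exact (point_apply t f).trans ((congrArg (Polynomial.eval · f) h).trans (point_apply t' f).symm)

end AffineLine

/-! ### Flat limits by saturation over `ℂ[X]`. -/

section FlatLimit

variable {ι : Type}

/-- The vectors of polynomials that lie in the span of `S` up to a nonzero polynomial factor. -/
def saturation (S : Set (ι → Polynomial ℂ)) : Submodule (Polynomial ℂ) (ι → Polynomial ℂ) where
  carrier := {f | ∃ q : Polynomial ℂ, q ≠ 0 ∧ q • f ∈ Submodule.span (Polynomial ℂ) S}
  zero_mem' := ⟨1, one_ne_zero, by simp⟩
  add_mem' := by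
    rintro f g ⟨p, hp, hf⟩ ⟨q, hq, hg⟩
    refine ⟨p * q, mul_ne_zero hp hq, ?_⟩
    rw [smul_add]
    refine add_mem ?_ ?_
    · rw [mul_comm, mul_smul]; exact Submodule.smul_mem _ _ hf
    · rw [mul_smul]; exact Submodule.smul_mem _ _ hg
  smul_mem' := by
    rintro c f ⟨p, hp, hf⟩
    exact ⟨p, hp, by rw [smul_comm]; exact Submodule.smul_mem _ _ hf⟩

theorem subset_saturation (S : Set (ι → Polynomial ℂ)) {f : ι → Polynomial ℂ} (hf : f ∈ S) :
    f ∈ saturation S :=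
  ⟨1, one_ne_zero, by simpa using Submodule.subset_span hf⟩

theorem mem_saturation_of_smul {S : Set (ι → Polynomial ℂ)} {f : ι → Polynomial ℂ}
    {q : Polynomial ℂ} (hq : q ≠ 0) (hf : q • f ∈ saturation S) : f ∈ saturation S := by
  obtain ⟨p, hp, h⟩ := hf
  exact ⟨p * q, mul_ne_zero hp hq, by rwa [mul_smul]⟩

/-- The value of a vector of polynomials. -/
noncomputable def evalVec (s : ℂ) (f : ι → Polynomial ℂ) : ι → ℂ := fun i => (f i).eval s

theorem evalVec_mem_span {S : Set (ι → Polynomial ℂ)} {f : ι → Polynomial ℂ}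
    (hf : f ∈ Submodule.span (Polynomial ℂ) S) (s : ℂ) :
    evalVec s f ∈ Submodule.span ℂ (evalVec s '' S) := by
  induction hf using Submodule.span_induction with
  | mem x hx => exact Submodule.subset_span ⟨x, hx, rfl⟩
  | zero => convert Submodule.zero_mem _ using 1; funext i; simp [evalVec]
  | add x y _ _ hx hy => convert add_mem hx hy using 1; funext i; simp [evalVec]
  | smul c x _ hx =>
    convert Submodule.smul_mem _ (c.eval s) hx using 1; funext i; simp [evalVec]

/-- A relation at `s` with constants `g j` makes `∑ g j • b j` divisible by `X - s`. Saturation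
keeps the quotient in the module, so each constant `g j` is divisible by `X - s`, hence zero. -/
theorem linearIndependent_evalVec {S : Set (ι → Polynomial ℂ)} {m : ℕ}
    (b : Module.Basis (Fin m) (Polynomial ℂ) (saturation S)) (s : ℂ) :
    LinearIndependent ℂ (fun j => evalVec s (b j : ι → Polynomial ℂ)) := by
  rw [Fintype.linearIndependent_iff]
  intro g hg
  have hroot : ∀ i, (Polynomial.X - Polynomial.C s) ∣
      (∑ j, Polynomial.C (g j) • (b j : ι → Polynomial ℂ)) i := by
    intro i
    rw [Polynomial.dvd_iff_isRoot, Polynomial.IsRoot]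
    have := congrFun hg i
    simpa [evalVec, Polynomial.eval_finsetSum] using this
  choose G hG using hroot
  have hG' : (Polynomial.X - Polynomial.C s) • G
      = ∑ j, Polynomial.C (g j) • (b j : ι → Polynomial ℂ) := by
    funext i; rw [hG]; rfl
  have hmem : G ∈ saturation S := by
    refine mem_saturation_of_smul (Polynomial.X_sub_C_ne_zero s) ?_
    rw [hG']
    exact Submodule.sum_mem _ fun j _ => Submodule.smul_mem _ _ (b j).2
  have heq : (Polynomial.X - Polynomial.C s) • (⟨G, hmem⟩ : saturation S)
      = ∑ j, Polynomial.C (g j) • b j := by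
    apply Subtype.ext
    simpa using hG'
  intro j
  have h1 := congrArg (fun z => b.repr z j) heq
  have h2 : (Polynomial.X - Polynomial.C s) * b.repr ⟨G, hmem⟩ j = Polynomial.C (g j) := by
    simp only [map_smul, map_sum, Module.Basis.repr_self, Finsupp.smul_apply,
      Finsupp.finsetSum_apply, smul_eq_mul] at h1
    simpa [Finsupp.single_apply] using h1
  simpa using (congrArg (Polynomial.eval s) h2).symm

/-- A family of subspaces spanned by vectors of polynomials has a flat limit, on which every limit
of a family of linear forms vanishing on the subspaces vanishes. -/
theorem exists_isFlatLimit [Fintype ι] (S : Set (ι → Polynomial ℂ))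
    (T : affineLine.Point → Submodule ℂ (ι → ℂ))
    (hT : ∀ t, T t = Submodule.span ℂ (evalVec (lineCoord t) '' S)) :
    ∃ T₀, IsFlatLimit affineLine (linePoint 0) T T₀ ∧
      ∀ A : ι → Polynomial ℂ, (∀ f ∈ S, ∑ i, A i * f i = 0) →
        ∀ w ∈ T₀, ∑ i, (A i).eval 0 * w i = 0 := by
  -- A submodule of a finite free module over a PID is free; a basis of the saturation is a frame at
  -- every point, including `0`.
  obtain ⟨m, b⟩ := Submodule.basisOfPid (Pi.basisFun (Polynomial ℂ) ι) (saturation S)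
  choose p hp hpb using fun j => (b j).2
  set q := ∏ j, p j with hq
  have hq0 : q ≠ 0 := Finset.prod_ne_zero_iff.2 fun j _ => hp j
  have hqb : ∀ j, q • (b j : ι → Polynomial ℂ) ∈ Submodule.span (Polynomial ℂ) S := by
    intro j
    obtain ⟨c, hc⟩ := Finset.dvd_prod_of_mem p (Finset.mem_univ j)
    rw [hq, hc, mul_comm, mul_smul]
    exact Submodule.smul_mem _ _ (hpb j)
  -- Away from the roots of the common denominator `q`, the frame spans the same space as `S`.
  -- Removing the power of `X` from `q` leaves `h` with `h(0) ≠ 0`, and away from `0` the roots of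
  -- `h` and `q` agree.
  obtain ⟨h, hqh, hh⟩ := Polynomial.exists_eq_pow_rootMultiplicity_mul_and_not_dvd q hq0 0
  have hpt : ∀ (t : affineLine.Point) (f : Fin m → ι → Polynomial ℂ),
      (fun j i => t (f j i)) = fun j => evalVec (lineCoord t) (f j) := by
    intro t f
    funext j i
    exact point_apply t _
  refine ⟨Submodule.span ℂ (Set.range fun j => evalVec 0 (b j : ι → Polynomial ℂ)),
    ⟨m, fun j => (b j : ι → Polynomial ℂ), h, ?_, ?_, ?_, ?_⟩, ?_⟩
  · rw [point_apply, lineCoord_linePoint]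
    rwa [Polynomial.dvd_iff_isRoot] at hh
  · intro t _
    rw [hpt]
    exact linearIndependent_evalVec b _
  · intro t ht ht0
    rw [hpt, hT]
    have hs : lineCoord t ≠ 0 := fun h0 => ht0 (lineCoord_injective (by simpa using h0))
    have hqs : q.eval (lineCoord t) ≠ 0 := by
      rw [point_apply] at ht
      rw [hqh]
      simpa [hs] using ht
    apply le_antisymm
    · rw [Submodule.span_le]
      rintro _ ⟨f, hf, rfl⟩
      have hfs : ∑ j, b.repr ⟨f, subset_saturation S hf⟩ j • (b j : ι → Polynomial ℂ) = f := by
        simpa only [Submodule.coe_sum, Submodule.coe_smul] using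
          congrArg Subtype.val (b.sum_repr ⟨f, subset_saturation S hf⟩)
      have : evalVec (lineCoord t) f = ∑ j, (b.repr ⟨f, subset_saturation S hf⟩ j).eval (lineCoord t)
          • evalVec (lineCoord t) (b j : ι → Polynomial ℂ) := by
        funext i
        have := congrArg (Polynomial.eval (lineCoord t)) (congrFun hfs i)
        simpa only [evalVec, Polynomial.eval_finsetSum, Finset.sum_apply, Pi.smul_apply,
          smul_eq_mul, Polynomial.eval_mul] using this.symm
      rw [this]
      exact Submodule.sum_mem _ fun j _ =>
        Submodule.smul_mem _ _ (Submodule.subset_span ⟨j, rfl⟩)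
    · rw [Submodule.span_le]
      rintro _ ⟨j, rfl⟩
      have := evalVec_mem_span (hqb j) (lineCoord t)
      have he : evalVec (lineCoord t) (q • (b j : ι → Polynomial ℂ))
          = q.eval (lineCoord t) • evalVec (lineCoord t) (b j : ι → Polynomial ℂ) := by
        funext i; simp [evalVec]
      rw [he] at this
      exact (Submodule.smul_mem_iff _ hqs).1 this
  · rw [hpt, lineCoord_linePoint]
  · intro A hA
    have hM : ∀ f ∈ Submodule.span (Polynomial ℂ) S, ∑ i, A i * f i = 0 := by
      intro f hf
      induction hf using Submodule.span_induction with
      | mem x hx => exact hA x hx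
      | zero => simp
      | add x y _ _ hx hy => simp [mul_add, Finset.sum_add_distrib, hx, hy]
      | smul c x _ hx =>
        simp only [Pi.smul_apply, smul_eq_mul, mul_left_comm _ c, ← Finset.mul_sum, hx, mul_zero]
    intro w hw
    induction hw using Submodule.span_induction with
    | mem x hx =>
      obtain ⟨j, rfl⟩ := hx
      have h1 := hM _ (hqb j)
      simp only [Pi.smul_apply, smul_eq_mul, mul_left_comm _ q, ← Finset.mul_sum] at h1
      have h2 := (mul_eq_zero.1 h1).resolve_left hq0
      simpa [Polynomial.eval_finsetSum, evalVec] using congrArg (Polynomial.eval 0) h2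
    | zero => simp
    | add x y _ _ hx hy => simp [mul_add, Finset.sum_add_distrib, hx, hy]
    | smul c x _ hx =>
      simp only [Pi.smul_apply, smul_eq_mul, mul_left_comm _ c, ← Finset.mul_sum, hx, mul_zero]

end FlatLimit

/-! ### Order of vanishing along lines. -/

section Order

variable {r : ℕ} {n d : Fin r → ℕ} {R : Type*} [CommRing R] {R' : Type*} [CommRing R']

/-- The parametrized line `T ↦ v + T y`. -/
noncomputable def jet (v y : (i : Fin r) → Fin (n i + 1) → R) :
    (i : Fin r) → Fin (n i + 1) → Polynomial R :=
  fun i c => Polynomial.C (v i c) + Polynomial.X * Polynomial.C (y i c)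

/-- The `e`-th Taylor coefficient of the Segre-Veronese embedding at `v` in the direction `y`. -/
noncomputable def jetCoeff (n d : Fin r → ℕ) (e : ℕ) (v y : (i : Fin r) → Fin (n i + 1) → R) :
    SVIndex n d → R :=
  fun J => (svCoord n d (jet v y) J).coeff e

/-- The restriction of a linear form to the image of the line `T ↦ v + T y`. -/
noncomputable def contact (a : SVIndex n d → R) (v y : (i : Fin r) → Fin (n i + 1) → R) :
    Polynomial R :=
  ∑ J, Polynomial.C (a J) * svCoord n d (jet v y) J

theorem coeff_contact (a : SVIndex n d → R) (v y : (i : Fin r) → Fin (n i + 1) → R) (e : ℕ) :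
    (contact a v y).coeff e = ∑ J, a J * jetCoeff n d e v y J := by
  simp [contact, jetCoeff, Polynomial.finsetSum_coeff]

theorem map_jetCoeff (φ : R →+* R') (e : ℕ) (v y : (i : Fin r) → Fin (n i + 1) → R)
    (J : SVIndex n d) :
    φ (jetCoeff n d e v y J)
      = jetCoeff n d e (fun i c => φ (v i c)) (fun i c => φ (y i c)) J := by
  rw [jetCoeff, jetCoeff, ← Polynomial.coeff_map, ← Polynomial.coe_mapRingHom, map_svCoord]
  unfold jet
  simp

theorem contact_prodForm (l : (i : Fin r) → Fin (d i) → Fin (n i + 1) → R)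
    (v y : (i : Fin r) → Fin (n i + 1) → R) :
    contact (prodForm l) v y = ∏ p : (Σ i, Fin (d i)),
      (Polynomial.C (l p.1 p.2 ⬝ᵥ v p.1) + Polynomial.X * Polynomial.C (l p.1 p.2 ⬝ᵥ y p.1)) := by
  simp only [contact, map_prodForm]
  rw [prodForm_dot, Fintype.prod_sigma]
  refine Finset.prod_congr rfl fun i _ => Finset.prod_congr rfl fun k _ => ?_
  simp only [dotProduct, jet, mul_add, Finset.sum_add_distrib, map_sum, map_mul, Finset.mul_sum]
  congr 1
  exact Finset.sum_congr rfl fun c _ => by ring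

theorem pow_dvd_prod {α : Type*} [Fintype α] {M : Type*} [CommMonoid M] (g : α → M) (x : M)
    (B : Finset α) {s : ℕ} (hs : s ≤ B.card) (h : ∀ p ∈ B, x ∣ g p) : x ^ s ∣ ∏ p, g p := by
  refine (pow_dvd_pow x hs).trans ?_
  rw [← Finset.prod_const]
  exact (Finset.prod_dvd_prod_of_dvd _ _ h).trans
    (Finset.prod_dvd_prod_of_subset _ _ _ (Finset.subset_univ _))

theorem pow_dvd_contact_prodForm (l : (i : Fin r) → Fin (d i) → Fin (n i + 1) → R)
    (v y : (i : Fin r) → Fin (n i + 1) → R) (B : Finset (Σ i, Fin (d i))) {s : ℕ}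
    (hs : s ≤ B.card) (h : ∀ p ∈ B, l p.1 p.2 ⬝ᵥ v p.1 = 0) :
    Polynomial.X ^ s ∣ contact (prodForm l) v y := by
  rw [contact_prodForm]
  refine pow_dvd_prod _ _ B hs fun p hp => ?_
  rw [h p hp, map_zero, zero_add]
  exact dvd_mul_right _ _

theorem contact_sum {κ : Type*} [Fintype κ] (b : κ → R) (a : κ → SVIndex n d → R)
    (v y : (i : Fin r) → Fin (n i + 1) → R) :
    contact (fun J => ∑ K, b K * a K J) v y = ∑ K, Polynomial.C (b K) * contact (a K) v y := by
  simp only [contact, map_sum, Finset.sum_mul, Finset.mul_sum, map_mul, mul_assoc]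
  exact Finset.sum_comm

/-- The linear form `a` vanishes to order `s` along all lines through `v`. -/
def VanishesAlongLines (v : (i : Fin r) → Fin (n i + 1) → ℂ) (s : ℕ) (a : SVIndex n d → ℂ) : Prop :=
  ∀ y, Polynomial.X ^ s ∣ contact a v y

/-- The linear combination with coefficients `b` of the monomials in the linear forms `x`. -/
noncomputable def formSum (x : (i : Fin r) → Fin (n i + 1) → Fin (n i + 1) → ℂ)
    (b : SVIndex n d → ℂ) : SVIndex n d → ℂ :=
  fun J => ∑ K, b K * prodForm (fun i k => x i (rep K i k)) J

theorem formSum_dot (x : (i : Fin r) → Fin (n i + 1) → Fin (n i + 1) → ℂ) (b : SVIndex n d → ℂ)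
    (u : (i : Fin r) → Fin (n i + 1) → ℂ) :
    ∑ J, formSum x b J * svCoord n d u J
      = ∑ K, b K * svCoord n d (fun i c => x i c ⬝ᵥ u i) K := by
  simp only [formSum, Finset.sum_mul, mul_assoc]
  rw [Finset.sum_comm]
  refine Finset.sum_congr rfl fun K _ => ?_
  rw [← Finset.mul_sum, prodForm_dot, svCoord_eq]

/-- In finite dimension injectivity suffices; since the coordinates `x i` take all values, a
combination in the kernel vanishes at every point. -/
theorem formSum_surjective {x : (i : Fin r) → Fin (n i + 1) → Fin (n i + 1) → ℂ}
    (hx : ∀ i, Function.Surjective (fun (u : Fin (n i + 1) → ℂ) c => x i c ⬝ᵥ u)) :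
    Function.Surjective (formSum (d := d) x) := by
  let M : (SVIndex n d → ℂ) →ₗ[ℂ] (SVIndex n d → ℂ) :=
    { toFun := formSum x
      map_add' := fun b b' => by
        funext J; simp [formSum, add_mul, Finset.sum_add_distrib]
      map_smul' := fun c b => by
        funext J; simp [formSum, Finset.mul_sum, mul_assoc] }
  have hinj : Function.Injective M := by
    rw [← LinearMap.ker_eq_bot, LinearMap.ker_eq_bot']
    intro b hb
    refine eq_zero_of_dot_svCoord (fun _ => 0) b fun w _ => ?_
    choose u hu using fun i => hx i (w i)
    have h := formSum_dot x b u
    rw [show formSum x b = 0 from hb] at h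
    have hw : (fun i c => x i c ⬝ᵥ u i) = w := funext hu
    rw [← hw, ← h]
    simp
  exact LinearMap.injective_iff_surjective.1 hinj

/-- The positions at which an ordered index differs from the base index `o`. -/
def offBase (o : (i : Fin r) → Fin (n i + 1)) (f : OrdIndex n d) : Finset (Σ i, Fin (d i)) :=
  Finset.univ.filter fun p => f p.1 p.2 ≠ o p.1

/-- In linear coordinates in which `v` is the base point, a linear form that vanishes at `v` to
order `s` involves only monomials of degree at least `s` in the other coordinates. -/
theorem VanishesAlongLines.exists_formSum {v : (i : Fin r) → Fin (n i + 1) → ℂ} {s : ℕ}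
    {a : SVIndex n d → ℂ} (ha : VanishesAlongLines v s a) (o : (i : Fin r) → Fin (n i + 1))
    {x : (i : Fin r) → Fin (n i + 1) → Fin (n i + 1) → ℂ}
    (hv : ∀ i c, x i c ⬝ᵥ v i = if c = o i then 1 else 0)
    (hx : ∀ i, Function.Surjective (fun (u : Fin (n i + 1) → ℂ) c => x i c ⬝ᵥ u)) :
    ∃ b, formSum x b = a ∧ ∀ K, b K ≠ 0 → s ≤ (offBase o (rep K)).card := by
  classical
  obtain ⟨b, rfl⟩ := formSum_surjective (d := d) hx a
  refine ⟨b, rfl, fun K hK => ?_⟩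
  by_contra! hlt
  set e := (offBase o (rep K)).card with he
  -- It suffices that the whole part of degree `e < s` in the off-base coordinates vanishes on an
  -- open set.
  have h0 : (fun K' => if (offBase o (rep K')).card = e then b K' else 0) = 0 := by
    refine eq_zero_of_dot_svCoord o _ fun w hw => ?_
    set w' : (i : Fin r) → Fin (n i + 1) → ℂ := fun i c => w i c / w i (o i) with hw'
    have hscale : ∀ K', svCoord n d w K' = (∏ i, w i (o i) ^ d i) * svCoord n d w' K' := by
      intro K'
      rw [← svCoord_smul]
      congr 1
      funext i c
      simp only [hw', Pi.smul_apply, smul_eq_mul]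
      rw [mul_div_cancel₀ _ (hw i)]
    -- With `w'` normalised to base coordinate `1`, the point `v + T y` has base coordinate `1` and
    -- other coordinates `T w'`. Each monomial is thus its value at `w'` times `T` to its off-base
    -- degree.
    choose y hy using fun i => hx i (fun c => if c = o i then 0 else w' i c)
    have hc : contact (formSum x b) v y = ∑ K', Polynomial.C (b K') *
        (Polynomial.X ^ (offBase o (rep K')).card * Polynomial.C (svCoord n d w' K')) := by
      rw [show formSum x b = fun J => ∑ K', b K' * prodForm (fun i k => x i (rep K' i k)) J from rfl,
        contact_sum]
      refine Finset.sum_congr rfl fun K' _ => ?_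
      rw [contact_prodForm]
      congr 1
      have hp : ∀ p : (Σ i, Fin (d i)),
          Polynomial.C (x p.1 (rep K' p.1 p.2) ⬝ᵥ v p.1)
            + Polynomial.X * Polynomial.C (x p.1 (rep K' p.1 p.2) ⬝ᵥ y p.1)
          = (if rep K' p.1 p.2 ≠ o p.1 then Polynomial.X else 1)
            * Polynomial.C (w' p.1 (rep K' p.1 p.2)) := by
        intro p
        rw [hv, show x p.1 (rep K' p.1 p.2) ⬝ᵥ y p.1 = _ from congrFun (hy p.1) _]
        by_cases h : rep K' p.1 p.2 = o p.1
        · simp [h, hw', div_self (hw p.1)]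
        · simp [h]
      rw [Finset.prod_congr rfl fun p _ => hp p, Finset.prod_mul_distrib, Finset.prod_ite,
        Finset.prod_const, Finset.prod_const_one, mul_one, svCoord_eq, ← map_prod,
        Fintype.prod_sigma]
      rfl
    have hcoeff := (Polynomial.X_pow_dvd_iff.1 (ha y)) e hlt
    rw [hc] at hcoeff
    simp only [Polynomial.finsetSum_coeff, Polynomial.coeff_C_mul, Polynomial.coeff_mul_C,
      Polynomial.coeff_X_pow] at hcoeff
    simp only [hscale, mul_left_comm _ (∏ i, w i (o i) ^ d i), ← Finset.mul_sum]
    refine mul_eq_zero_of_right _ (Eq.trans (Finset.sum_congr rfl fun K' _ => ?_) hcoeff)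
    by_cases h : (offBase o (rep K')).card = e
    · simp [h]
    · simp [h, Ne.symm h]
  have := congrFun h0 K
  simp only [Pi.zero_apply, ite_eq_right_iff] at this
  exact hK (this he.symm)

end Order

/-! ### Osculating spaces through Taylor coefficients. -/

section Vanishing

variable {r : ℕ} {n d : Fin r → ℕ}

theorem mem_projIdeal_iff {ι : Type} {V : Set (Projectivization ℂ (ι → ℂ))} {f : MvPolynomial ι ℂ} :
    f ∈ projIdeal V ↔ ∀ z ∈ cone V, MvPolynomial.eval z f = 0 := by
  simp [projIdeal, MvPolynomial.mem_vanishingIdeal_iff, MvPolynomial.aeval_eq_eval]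

theorem eval_linForm {ι : Type} [Fintype ι] (a z : ι → ℂ) :
    MvPolynomial.eval z (linForm a) = ∑ i, a i * z i := by
  simp [linForm]

theorem Represents.smul {ι : Type} {v : ι → ℂ} {p : Projectivization ℂ (ι → ℂ)}
    (h : Represents v p) {c : ℂ} (hc : c ≠ 0) : Represents (c • v) p := by
  obtain ⟨hv, rfl⟩ := h
  exact ⟨smul_ne_zero hc hv, (Projectivization.mk_eq_mk_iff' ℂ _ _ _ _).2 ⟨c, rfl⟩⟩

theorem Represents.exists_smul {ι : Type} {v w : ι → ℂ} {p : Projectivization ℂ (ι → ℂ)}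
    (h : Represents v p) (h' : Represents w p) : ∃ c : ℂ, c ≠ 0 ∧ w = c • v := by
  obtain ⟨hv, rfl⟩ := h
  obtain ⟨hw, hh⟩ := h'
  obtain ⟨c, hc⟩ := (Projectivization.mk_eq_mk_iff' ℂ _ _ _ _).1 hh
  refine ⟨c, ?_, hc.symm⟩
  rintro rfl
  exact hw (by rw [← hc, zero_smul])

theorem svVec_ne_zero {v : (i : Fin r) → Fin (n i + 1) → ℂ} (hv : ∀ i, v i ≠ 0) :
    svVec n d v ≠ 0 := by
  choose c hc using fun i => Function.ne_iff.1 (hv i)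
  intro h
  have h1 := congrFun h (OrdIndex.toSV fun i (_ : Fin (d i)) => c i)
  rw [svVec_eq_svCoord, svCoord_toSV] at h1
  exact Finset.prod_ne_zero_iff.2 (fun i _ => Finset.prod_ne_zero_iff.2 fun k _ => hc i) h1

theorem represents_svVec_mem {v : (i : Fin r) → Fin (n i + 1) → ℂ} (hv : ∀ i, v i ≠ 0) {c : ℂ}
    (hc : c ≠ 0) : c • svVec n d v ∈ cone (segreVeronese n d) :=
  ⟨Projectivization.mk ℂ (svVec n d v) (svVec_ne_zero hv), ⟨v, hv, svVec_ne_zero hv, rfl⟩,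
    Represents.smul ⟨svVec_ne_zero hv, rfl⟩ hc⟩

/-- Each factor excludes at most one `τ`. Hence a polynomial in `τ` that vanishes at all parameters
giving points of the variety is zero. -/
theorem infinite_line_ne_zero {v : (i : Fin r) → Fin (n i + 1) → ℂ} (hv : ∀ i, v i ≠ 0)
    (y : (i : Fin r) → Fin (n i + 1) → ℂ) : {τ : ℂ | ∀ i, v i + τ • y i ≠ 0}.Infinite := by
  have h : {τ : ℂ | ∀ i, v i + τ • y i ≠ 0}ᶜ.Finite := by
    have : {τ : ℂ | ∀ i, v i + τ • y i ≠ 0}ᶜ = ⋃ i, {τ : ℂ | v i + τ • y i = 0} := by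
      ext τ; simp
    rw [this]
    refine Set.finite_iUnion fun i => Set.Subsingleton.finite ?_
    intro τ hτ τ' hτ'
    simp only [Set.mem_ofPred_eq] at hτ hτ'
    have h1 : (τ - τ') • y i = 0 := by
      rw [sub_smul, sub_eq_zero]
      exact add_left_cancel (hτ.trans hτ'.symm)
    rcases smul_eq_zero.1 h1 with h2 | h2
    · exact sub_eq_zero.1 h2
    · rw [h2, smul_zero, add_zero] at hτ
      exact absurd hτ (hv i)
  exact Set.infinite_of_finite_compl h

theorem eval_svCoord_jet (v y : (i : Fin r) → Fin (n i + 1) → ℂ) (τ : ℂ) (J : SVIndex n d) :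
    Polynomial.eval τ (svCoord n d (jet v y) J) = svVec n d (fun i => v i + τ • y i) J := by
  rw [svVec_eq_svCoord, ← Polynomial.coe_evalRingHom, map_svCoord]
  unfold jet
  congr 1
  funext i c
  simp only [Polynomial.coe_evalRingHom, Polynomial.eval_add, Polynomial.eval_mul,
    Polynomial.eval_C, Polynomial.eval_X, Pi.add_apply, Pi.smul_apply, smul_eq_mul]

/-- Substituting the line `v + T y` is a ring map to `ℂ[T]` that kills `I(V)`, sends `I(p) ^ s` into
`(T ^ s)`, and gives `G` a nonzero constant term. As `T` is prime, `G` can be cancelled. -/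
theorem VanishesToOrder.vanishesAlongLines {v : (i : Fin r) → Fin (n i + 1) → ℂ}
    (hv : ∀ i, v i ≠ 0) {p : Projectivization ℂ (SVIndex n d → ℂ)} (hp : Represents (svVec n d v) p)
    {s : ℕ} {a : SVIndex n d → ℂ} (ha : VanishesToOrder (segreVeronese n d) p s a) :
    VanishesAlongLines v s a := by
  intro y
  obtain ⟨G, hG, hmem⟩ := ha
  rw [mem_projIdeal_iff] at hG
  push Not at hG
  obtain ⟨z, ⟨p', hp', hz⟩, hGz⟩ := hG
  obtain rfl : p' = p := hp'
  obtain ⟨c, hc, rfl⟩ := hp.exists_smul hz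
  let φ : MvPolynomial (SVIndex n d) ℂ →ₐ[ℂ] Polynomial ℂ :=
    MvPolynomial.aeval fun J => Polynomial.C c * svCoord n d (jet v y) J
  have heval : ∀ τ f, Polynomial.eval τ (φ f)
      = MvPolynomial.eval (c • svVec n d fun i => v i + τ • y i) f := by
    intro τ f
    rw [← Polynomial.coe_aeval_eq_eval, ← AlgHom.comp_apply, MvPolynomial.comp_aeval,
      MvPolynomial.aeval_eq_eval]
    congr 2
    funext J
    simp [Polynomial.coe_aeval_eq_eval, eval_svCoord_jet]
  have h0 : ∀ f, Polynomial.eval 0 (φ f) = MvPolynomial.eval (c • svVec n d v) f := by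
    intro f; rw [heval]; simp
  have hV : projIdeal (segreVeronese n d) ≤ (Ideal.span {Polynomial.X ^ s}).comap φ := by
    intro f hf
    rw [mem_projIdeal_iff] at hf
    have : φ f = 0 := by
      refine Polynomial.eq_zero_of_infinite_isRoot _ ((infinite_line_ne_zero hv y).mono ?_)
      intro τ hτ
      change Polynomial.eval τ (φ f) = 0
      rw [heval]
      exact hf _ (represents_svVec_mem hτ hc)
    rw [Ideal.mem_comap, this]
    exact Ideal.zero_mem _
  have hI : projIdeal {p'} ^ s ≤ (Ideal.span {Polynomial.X ^ s}).comap φ := by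
    rw [← Ideal.span_singleton_pow]
    refine le_trans (Ideal.pow_right_mono ?_ s) (Ideal.le_comap_pow φ s)
    intro f hf
    rw [mem_projIdeal_iff] at hf
    rw [Ideal.mem_comap, Ideal.mem_span_singleton, Polynomial.X_dvd_iff,
      Polynomial.coeff_zero_eq_eval_zero, h0]
    exact hf _ ⟨p', rfl, hz⟩
  have h1 := sup_le hV hI hmem
  rw [Ideal.mem_comap, Ideal.mem_span_singleton, map_mul] at h1
  have h2 := Polynomial.prime_X.pow_dvd_of_dvd_mul_left s (by
    rw [Polynomial.X_dvd_iff, Polynomial.coeff_zero_eq_eval_zero, h0]; exact hGz) h1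
  have h3 : φ (linForm a) = Polynomial.C c * contact a v y := by
    simp [φ, linForm, contact, Finset.mul_sum, Polynomial.C_eq_algebraMap, mul_left_comm]
  rw [h3] at h2
  exact (Polynomial.isUnit_C.2 hc.isUnit).dvd_mul_left.1 h2

/-- The ordered index equal to `f` at the position `p` and to the base index `o` elsewhere. -/
def changeAt (o : (i : Fin r) → Fin (n i + 1)) (f : OrdIndex n d) (p : Σ i, Fin (d i)) :
    OrdIndex n d :=
  fun i k => if (⟨i, k⟩ : Σ i, Fin (d i)) = p then f i k else o i

theorem prod_mem_pow {A P : Type*} [CommRing A] [Fintype P] (I : Ideal A) (g : P → A)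
    (B : Finset P) {s : ℕ} (hs : s ≤ B.card) (h : ∀ p ∈ B, g p ∈ I) : ∏ p, g p ∈ I ^ s := by
  classical
  rw [← Finset.prod_mul_prod_compl B]
  refine Ideal.mul_mem_right _ _ (Ideal.pow_le_pow_right hs ?_)
  rw [← Finset.prod_const]
  exact Ideal.prod_mem_prod h

/-- Changing all factors at once is traded for changing one factor at a time, so that on the variety
a monomial becomes, up to powers of the base monomial, a product of ambient linear forms. -/
theorem prod_change_identity {P : Type*} [Fintype P] [DecidableEq P] (g h : P → ℂ) :
    (∏ p, g p) ^ Fintype.card P * ∏ p, h p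
      = (∏ p, g p) * ∏ p, ∏ p', (if p' = p then h p' else g p') := by
  have h1 : ∀ (k : P → ℂ) (p : P), ∏ p', (if p' = p then k p' else g p')
      = k p * ∏ p' ∈ Finset.univ.erase p, g p' := by
    intro k p
    rw [← Finset.mul_prod_erase _ _ (Finset.mem_univ p), if_pos rfl]
    congr 1
    exact Finset.prod_congr rfl fun p' hp' => if_neg (Finset.ne_of_mem_erase hp')
  have h2 : (∏ p, g p) ^ Fintype.card P = ∏ p : P, (g p * ∏ p' ∈ Finset.univ.erase p, g p') := by
    rw [← Finset.card_univ, ← Finset.prod_const]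
    exact Finset.prod_congr rfl fun p _ => (Finset.mul_prod_erase _ _ (Finset.mem_univ p)).symm
  rw [h2, Finset.prod_congr rfl fun p _ => h1 h p, Finset.prod_mul_distrib, Finset.prod_mul_distrib]
  ring

theorem prodForm_dot_sigma (l : (i : Fin r) → Fin (d i) → Fin (n i + 1) → ℂ)
    (u : (i : Fin r) → Fin (n i + 1) → ℂ) :
    ∑ J, prodForm l J * svVec n d u J = ∏ p : (Σ i, Fin (d i)), l p.1 p.2 ⬝ᵥ u p.1 := by
  rw [svVec_eq_svCoord, prodForm_dot, Fintype.prod_sigma]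

/-- The base monomial `q₀` is nonzero at `p`, so a power of it serves as `G`. Modulo `I(V)`, this
power times a monomial is `q₀` times a product of one-factor changes `q f p`; those at off-base
positions lie in `I(p)`, and there are at least `s` of them. -/
theorem VanishesAlongLines.vanishesToOrder {v : (i : Fin r) → Fin (n i + 1) → ℂ}
    (hv : ∀ i, v i ≠ 0) {p : Projectivization ℂ (SVIndex n d → ℂ)} (hp : Represents (svVec n d v) p)
    {s : ℕ} {a : SVIndex n d → ℂ} (ha : VanishesAlongLines v s a) :
    VanishesToOrder (segreVeronese n d) p s a := by
  classical
  have hli : ∀ i, LinearIndependent ℂ (fun _ : Fin 1 => v i) := fun i =>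
    LinearIndependent.of_subsingleton 0 (hv i)
  choose σ x _ hxv hx using fun i => exists_dual_coordinates (hli i)
  set o : (i : Fin r) → Fin (n i + 1) := fun i => σ i 0 with ho
  have hxv' : ∀ i c, x i c ⬝ᵥ v i = if c = o i then 1 else 0 := fun i c => hxv i c 0
  obtain ⟨b, rfl, hb⟩ := ha.exists_formSum o hxv' hx
  let q₀ := linForm (prodForm (n := n) (d := d) fun i _ => x i (o i))
  let q := fun (f : OrdIndex n d) (p : Σ i, Fin (d i)) =>
    linForm (prodForm fun i k => x i (changeAt o f p i k))
  have key : ∀ (f : OrdIndex n d) (c : ℂ) (u : (i : Fin r) → Fin (n i + 1) → ℂ),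
      MvPolynomial.eval (c • svVec n d u)
        (q₀ ^ Fintype.card (Σ i, Fin (d i)) * linForm (prodForm fun i k => x i (f i k))
          - q₀ * ∏ p, q f p) = 0 := by
    intro f c u
    have hl : ∀ l : (i : Fin r) → Fin (d i) → Fin (n i + 1) → ℂ,
        MvPolynomial.eval (c • svVec n d u) (linForm (prodForm l))
          = c * ∏ p : (Σ i, Fin (d i)), l p.1 p.2 ⬝ᵥ u p.1 := by
      intro l
      rw [eval_linForm, ← prodForm_dot_sigma]
      simp [Finset.mul_sum, mul_left_comm]
    simp only [map_sub, map_mul, map_pow, map_prod, q₀, q, hl, Finset.prod_mul_distrib,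
      Finset.prod_const, Finset.card_univ]
    have := prod_change_identity (fun p : (Σ i, Fin (d i)) => x p.1 (o p.1) ⬝ᵥ u p.1)
      (fun p : (Σ i, Fin (d i)) => x p.1 (f p.1 p.2) ⬝ᵥ u p.1)
    have h2 : ∀ p p' : (Σ i, Fin (d i)), x p'.1 (changeAt o f p p'.1 p'.2) ⬝ᵥ u p'.1
        = if p' = p then x p'.1 (f p'.1 p'.2) ⬝ᵥ u p'.1 else x p'.1 (o p'.1) ⬝ᵥ u p'.1 := by
      intro p p'
      by_cases h : p' = p <;> simp [changeAt, h]
    simp only [h2]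
    rw [mul_pow]
    linear_combination (c ^ Fintype.card (Σ i, Fin (d i)) * c) * this
  refine ⟨q₀ ^ Fintype.card (Σ i, Fin (d i)), ?_, ?_⟩
  · rw [mem_projIdeal_iff]
    intro h
    have h1 := h _ ⟨p, rfl, hp⟩
    rw [map_pow, eval_linForm, prodForm_dot_sigma] at h1
    simp [hxv'] at h1
  · have hsum : linForm (formSum x b) = ∑ K, MvPolynomial.C (b K) *
        linForm (prodForm (d := d) fun i k => x i (rep K i k)) := by
      simp only [linForm, formSum, map_sum, map_mul, Finset.sum_mul, Finset.mul_sum, mul_assoc]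
      exact Finset.sum_comm
    rw [hsum, Finset.mul_sum]
    refine Ideal.sum_mem _ fun K _ => ?_
    by_cases hK : b K = 0
    · simp [hK]
    rw [mul_left_comm]
    refine Ideal.mul_mem_left _ _ ?_
    rw [← sub_add_cancel (q₀ ^ Fintype.card (Σ i, Fin (d i)) * _) (q₀ * ∏ p, q (rep K) p)]
    refine Ideal.add_mem _ (Ideal.mem_sup_left ?_) (Ideal.mem_sup_right ?_)
    · rw [mem_projIdeal_iff]
      rintro z ⟨p', ⟨u, hu, hup⟩, hz⟩
      obtain ⟨c, hc, rfl⟩ := hup.exists_smul hz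
      exact key _ c u
    · refine Ideal.mul_mem_left _ _ (prod_mem_pow _ _ _ (hb K hK) fun p' hp' => ?_)
      rw [mem_projIdeal_iff]
      rintro z ⟨p'', hp'', hz⟩
      obtain rfl : p'' = p := hp''
      obtain ⟨c, hc, rfl⟩ := hp.exists_smul hz
      rw [eval_linForm]
      simp only [Pi.smul_apply, smul_eq_mul, mul_left_comm _ c, ← Finset.mul_sum]
      rw [prodForm_dot_sigma, Finset.prod_eq_zero (Finset.mem_univ p'), mul_zero]
      simp only [offBase, Finset.mem_filter, Finset.mem_univ, true_and] at hp'
      simp [changeAt, hxv', hp']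

/-- Osculating spaces of Segre-Veronese varieties are spanned by Taylor coefficients. -/
theorem osculatingSpace_eq_span {v : (i : Fin r) → Fin (n i + 1) → ℂ} (hv : ∀ i, v i ≠ 0)
    {p : Projectivization ℂ (SVIndex n d → ℂ)} (hp : Represents (svVec n d v) p) (m : ℕ) :
    osculatingSpace (segreVeronese n d) m p
      = Submodule.span ℂ {w | ∃ e ≤ m, ∃ y, w = jetCoeff n d e v y} := by
  apply le_antisymm
  · intro w hw
    by_contra hnot
    -- A functional separating `w` from the span is a linear form with no Taylor coefficient of
    -- order at most `m` along any line, so it must kill `w`.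
    obtain ⟨φ, hφw, hφ⟩ := Submodule.exists_le_ker_of_notMem hnot
    have hdot : ∀ z, φ z = ∑ J, φ (Pi.single J 1) * z J := by
      classical
      intro z
      conv_lhs => rw [← (Pi.basisFun ℂ (SVIndex n d)).sum_repr z]
      simp [map_sum, mul_comm]
    apply hφw
    rw [hdot]
    refine hw _ (VanishesAlongLines.vanishesToOrder hv hp fun y => ?_)
    rw [Polynomial.X_pow_dvd_iff]
    intro e he
    rw [coeff_contact, ← hdot]
    exact hφ (Submodule.subset_span ⟨e, Nat.lt_succ_iff.1 he, y, rfl⟩)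
  · rw [Submodule.span_le]
    rintro _ ⟨e, he, y, rfl⟩ a ha
    have := VanishesToOrder.vanishesAlongLines hv hp ha y
    rw [← coeff_contact]
    exact Polynomial.X_pow_dvd_iff.1 this e (Nat.lt_succ_iff.2 he)

end Vanishing

/-! ### Deforming linear forms along the moving points. -/

section Degeneration

/-- Given disjoint sets `M j` of positions in `D`, one can choose a set `B` of positions such that
enough positions of `D` lie outside `B`, and enough positions lie outside both `M j` and `B` or in
both of them. -/
theorem exists_balancing_set {P κ : Type*} [DecidableEq P] {k₁ k₂ : ℕ} (D : Finset P)
    (M : κ → Finset P) (hM : ∀ j, M j ⊆ D) (hdisj : ∀ j j', j ≠ j' → Disjoint (M j) (M j'))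
    (h : k₂ ≤ k₁ ∨ Subsingleton κ) (hD : k₁ + k₂ + 2 ≤ D.card) :
    ∃ B : Finset P, k₁ + 1 ≤ (D \ B).card ∧
      ∀ j, k₂ + 1 ≤ (((D \ M j) \ B) ∪ (M j ∩ B)).card := by
  by_cases hbig : ∃ j, k₁ + 1 < (M j).card
  -- Deform all of the large `M j` except a subset `A` of `k₁ + 1` positions: `A` serves the fixed
  -- point, and `D \ A`, with at least `k₂ + 1` elements, serves the index `j`.
  · obtain ⟨j, hj⟩ := hbig
    obtain ⟨A, hAM, hA⟩ := Finset.exists_subset_card_eq hj.le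
    have hAB : A ⊆ D \ (M j \ A) := fun p hp => by
      simp [hM j (hAM hp), hp]
    refine ⟨M j \ A, hA ▸ Finset.card_le_card hAB, fun j' => ?_⟩
    by_cases hjj : j' = j
    · subst hjj
      have h1 : D \ A ⊆ ((D \ M j') \ (M j' \ A)) ∪ (M j' ∩ (M j' \ A)) := fun p hp => by
        simp only [Finset.mem_sdiff, Finset.mem_union, Finset.mem_inter] at hp ⊢
        tauto
      refine le_trans ?_ (Finset.card_le_card h1)
      rw [Finset.card_sdiff_of_subset (hAM.trans (hM j'))]
      omega
    · rcases h with h | h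
      · have h1 : A ⊆ ((D \ M j') \ (M j \ A)) ∪ (M j' ∩ (M j \ A)) := fun p hp => by
          have := Finset.disjoint_left.1 (hdisj j j' (Ne.symm hjj)) (hAM hp)
          simp [hM j (hAM hp), hp, this]
        exact le_trans (by omega) (Finset.card_le_card h1)
      · exact absurd (Subsingleton.elim j' j) hjj
  -- If every `M j` has at most `k₁ + 1` elements, nothing has to be deformed.
  · push Not at hbig
    refine ⟨∅, by simp; omega, fun j => ?_⟩
    have := hbig j
    have h2 := Finset.card_sdiff_of_subset (hM j)
    simp only [Finset.sdiff_empty, Finset.inter_empty, Finset.union_empty]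
    omega

variable {r m : ℕ} {n d : Fin r → ℕ} [NeZero m]

/-- The points on the line through `v 0` and `v j`, over the polynomial ring. -/
noncomputable def genericPoint (v : Fin m → (i : Fin r) → Fin (n i + 1) → ℂ) (j : Fin m) :
    (i : Fin r) → Fin (n i + 1) → Polynomial ℂ :=
  fun i c => (1 - Polynomial.X) * Polynomial.C (v 0 i c) + Polynomial.X * Polynomial.C (v j i c)

/-- The constant family with value `v`. -/
noncomputable def constPoint (v : (i : Fin r) → Fin (n i + 1) → ℂ) :
    (i : Fin r) → Fin (n i + 1) → Polynomial ℂ :=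
  fun i c => Polynomial.C (v i c)

open Classical in
/-- The linear forms `x i (f i k)`, replaced by `(1 - X) x i (f i k) - X x i (o i)` at the
positions in `B`. -/
noncomputable def movedForm (x : (i : Fin r) → Fin (n i + 1) → Fin (n i + 1) → ℂ)
    (o : (i : Fin r) → Fin (n i + 1)) (f : OrdIndex n d) (B : Finset (Σ i, Fin (d i))) :
    (i : Fin r) → Fin (d i) → Fin (n i + 1) → Polynomial ℂ :=
  fun i k c => if ⟨i, k⟩ ∈ B then
      (1 - Polynomial.X) * Polynomial.C (x i (f i k) c) - Polynomial.X * Polynomial.C (x i (o i) c)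
    else Polynomial.C (x i (f i k) c)

theorem C_dot {N : ℕ} (a u : Fin N → ℂ) :
    (fun c => Polynomial.C (a c)) ⬝ᵥ (fun c => Polynomial.C (u c)) = Polynomial.C (a ⬝ᵥ u) := by
  simp [dotProduct, map_sum]

theorem C_dot_genericPoint (v : Fin m → (i : Fin r) → Fin (n i + 1) → ℂ) (j : Fin m) (i : Fin r)
    (a : Fin (n i + 1) → ℂ) :
    (fun c => Polynomial.C (a c)) ⬝ᵥ genericPoint v j i
      = (1 - Polynomial.X) * Polynomial.C (a ⬝ᵥ v 0 i) + Polynomial.X * Polynomial.C (a ⬝ᵥ v j i) := by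
  simp only [dotProduct, genericPoint, map_sum, map_mul, Finset.mul_sum, ← Finset.sum_add_distrib]
  exact Finset.sum_congr rfl fun c _ => by ring

/-- A linear form vanishing at `v 0` to order `k₁ + k₂ + 2` is a limit of linear forms that vanish
to order `k₁ + 1` at `v 0` and to order `k₂ + 1` at the moving points. -/
theorem exists_moving_form {v : Fin m → (i : Fin r) → Fin (n i + 1) → ℂ}
    (hv : ∀ i, LinearIndependent ℂ fun j => v j i) {k₁ k₂ : ℕ} (h : k₂ ≤ k₁ ∨ m ≤ 2)
    {a : SVIndex n d → ℂ} (ha : VanishesAlongLines (v 0) (k₁ + k₂ + 2) a) :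
    ∃ A : SVIndex n d → Polynomial ℂ, (∀ J, (A J).eval 0 = a J) ∧
      (∀ y, Polynomial.X ^ (k₁ + 1) ∣ contact A (constPoint (v 0)) y) ∧
      ∀ j, j ≠ 0 → ∀ y, Polynomial.X ^ (k₂ + 1) ∣ contact A (genericPoint v j) y := by
  classical
  choose σ x hσ hxv hx using fun i => exists_dual_coordinates (hv i)
  set o : (i : Fin r) → Fin (n i + 1) := fun i => σ i 0 with ho
  obtain ⟨b, rfl, hb⟩ := ha.exists_formSum o (fun i c => hxv i c 0) hx
  let M : OrdIndex n d → {j : Fin m // j ≠ 0} → Finset (Σ i, Fin (d i)) := fun f j =>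
    Finset.univ.filter fun p => f p.1 p.2 = σ p.1 j
  have hB : ∀ K, ∃ B : Finset (Σ i, Fin (d i)), b K ≠ 0 →
      k₁ + 1 ≤ (offBase o (rep K) \ B).card ∧
      ∀ j, k₂ + 1 ≤ (((offBase o (rep K) \ M (rep K) j) \ B) ∪ (M (rep K) j ∩ B)).card := by
    intro K
    by_cases hK : b K = 0
    · exact ⟨∅, fun h => absurd hK h⟩
    obtain ⟨B, hB⟩ := exists_balancing_set (k₁ := k₁) (k₂ := k₂) (offBase o (rep K)) (M (rep K))
      (fun j p hp => by
        simp only [M, offBase, Finset.mem_filter, Finset.mem_univ, true_and, ho] at hp ⊢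
        rw [hp]
        exact fun h => j.2 (hσ _ h))
      (fun j j' hjj => by
        rw [Finset.disjoint_left]
        intro p hp hp'
        simp only [M, Finset.mem_filter, Finset.mem_univ, true_and] at hp hp'
        exact hjj (Subtype.ext (hσ _ (hp.symm.trans hp'))))
      (h.imp id fun hm => ⟨fun j j' => by
        have h1 : (j : Fin m).val ≠ 0 := fun h => j.2 (Fin.ext (by simpa using h))
        have h2 : (j' : Fin m).val ≠ 0 := fun h => j'.2 (Fin.ext (by simpa using h))
        have h3 := (j : Fin m).isLt
        have h4 := (j' : Fin m).isLt
        exact Subtype.ext (Fin.ext (by omega))⟩)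
      (hb K hK)
    exact ⟨B, fun _ => hB⟩
  choose B hB using hB
  have hcontact : ∀ (s : ℕ) (u : (i : Fin r) → Fin (n i + 1) → Polynomial ℂ),
      (∀ K, b K ≠ 0 → ∃ E : Finset (Σ i, Fin (d i)), s ≤ E.card ∧
        ∀ p ∈ E, movedForm x o (rep K) (B K) p.1 p.2 ⬝ᵥ u p.1 = 0) →
      ∀ y, Polynomial.X ^ s ∣ contact
        (fun J => ∑ K, Polynomial.C (b K) * prodForm (movedForm x o (rep K) (B K)) J) u y := by
    intro s u hE y
    rw [contact_sum]
    refine Finset.dvd_sum fun K _ => ?_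
    by_cases hK : b K = 0
    · simp [hK]
    obtain ⟨E, hE, hE'⟩ := hE K hK
    exact (pow_dvd_contact_prodForm _ _ _ E hE hE').mul_left _
  -- Each monomial is deformed with its own balancing set `B K`; at `X = 0` the deformation is
  -- trivial.
  refine ⟨fun J => ∑ K, Polynomial.C (b K) * prodForm (movedForm x o (rep K) (B K)) J, ?_, ?_, ?_⟩
  · intro J
    rw [Polynomial.eval_finsetSum]
    refine Finset.sum_congr rfl fun K _ => ?_
    rw [Polynomial.eval_mul, Polynomial.eval_C, ← Polynomial.coe_evalRingHom, map_prodForm]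
    congr 2
    funext i k c
    simp only [movedForm]
    split_ifs <;> simp
  · refine hcontact _ _ fun K hK => ⟨_, (hB K hK).1, fun p hp => ?_⟩
    simp only [offBase, Finset.mem_sdiff, Finset.mem_filter, Finset.mem_univ, true_and] at hp
    have h1 : movedForm x o (rep K) (B K) p.1 p.2
        = fun c => Polynomial.C (x p.1 (rep K p.1 p.2) c) := by
      funext c; exact if_neg hp.2
    rw [h1]
    refine (C_dot _ _).trans ?_
    rw [hxv, if_neg hp.1, map_zero]
  · intro j hj
    refine hcontact _ _ fun K hK => ⟨_, (hB K hK).2 ⟨j, hj⟩, fun p hp => ?_⟩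
    simp only [M, offBase, Finset.mem_sdiff, Finset.mem_filter, Finset.mem_univ, true_and,
      Finset.mem_union, Finset.mem_inter] at hp
    rcases hp with ⟨⟨hp1, hp2⟩, hp3⟩ | ⟨hp1, hp2⟩
    -- Undeformed factor: it vanishes at both `v 0` and `v j`, hence on the line joining them.
    · have h1 : movedForm x o (rep K) (B K) p.1 p.2
          = fun c => Polynomial.C (x p.1 (rep K p.1 p.2) c) := by
        funext c; exact if_neg hp3
      rw [h1, C_dot_genericPoint, hxv, hxv, if_neg hp1, if_neg hp2]
      simp
    -- Deformed factor: at the moving point it is `(1 - X) * X - X * (1 - X) = 0`.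
    · have h1 : movedForm x o (rep K) (B K) p.1 p.2
          = (1 - Polynomial.X : Polynomial ℂ) • (fun c => Polynomial.C (x p.1 (rep K p.1 p.2) c))
            - (Polynomial.X : Polynomial ℂ) • (fun c => Polynomial.C (x p.1 (o p.1) c)) := by
        funext c; exact if_pos hp2
      have h2 : σ p.1 j ≠ σ p.1 0 := fun h => hj (hσ _ h)
      rw [h1, sub_dotProduct, smul_dotProduct, smul_dotProduct, C_dot_genericPoint,
        C_dot_genericPoint, hxv, hxv, hxv, hxv, hp1, if_neg h2, if_pos rfl, if_pos rfl,
        if_neg (Ne.symm h2)]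
      simp
      ring

/-- The point with parameter `s` on the line through `v 0` and `v j`. -/
def linePt (v : Fin m → (i : Fin r) → Fin (n i + 1) → ℂ) (j : Fin m) (s : ℂ) :
    (i : Fin r) → Fin (n i + 1) → ℂ :=
  fun i => (1 - s) • v 0 i + s • v j i

/-- The flat limit of the spans of osculating spaces, when the points move along the lines that
join the factors of the points, is contained in an osculating space. -/
theorem exists_isFlatLimit_osculating {v : Fin m → (i : Fin r) → Fin (n i + 1) → ℂ}
    (hv : ∀ i, LinearIndependent ℂ fun j => v j i) {k₁ k₂ : ℕ} (h : k₂ ≤ k₁ ∨ m ≤ 2)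
    {p : Projectivization ℂ (SVIndex n d → ℂ)} (hp : Represents (svVec n d (v 0)) p)
    {γ : Fin m → affineLine.Point → Projectivization ℂ (SVIndex n d → ℂ)}
    (hγ : ∀ j t, Represents (svVec n d (linePt v j (lineCoord t))) (γ j t))
    (hne : ∀ j s i, linePt v j s i ≠ 0) :
    ∃ T₀ : Submodule ℂ (SVIndex n d → ℂ),
      IsFlatLimit affineLine (linePoint 0) (fun t => osculatingSpace (segreVeronese n d) k₁ p ⊔
        ⨆ (j : Fin m) (_ : j ≠ 0), osculatingSpace (segreVeronese n d) k₂ (γ j t)) T₀ ∧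
      T₀ ≤ osculatingSpace (segreVeronese n d) (k₁ + k₂ + 1) p := by
  have hv0 : ∀ i, v 0 i ≠ 0 := fun i => (hv i).ne_zero 0
  -- Constant directions `y` suffice: specialising these Taylor coefficients at any parameter yields
  -- generators of the osculating spaces there.
  set S : Set (SVIndex n d → Polynomial ℂ) :=
    {F | (∃ e ≤ k₁, ∃ y, F = jetCoeff n d e (constPoint (v 0)) (constPoint y)) ∨
      ∃ j : Fin m, j ≠ 0 ∧ ∃ e ≤ k₂, ∃ y, F = jetCoeff n d e (genericPoint v j) (constPoint y)}
    with hS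
  have hev : ∀ s e (u : (i : Fin r) → Fin (n i + 1) → Polynomial ℂ) y,
      evalVec s (jetCoeff n d e u (constPoint y))
        = jetCoeff n d e (fun i c => (u i c).eval s) y := by
    intro s e u y
    funext J
    simp only [evalVec]
    rw [← Polynomial.coe_evalRingHom, map_jetCoeff]
    simp [constPoint]
  have hev1 : ∀ s e y, evalVec s (jetCoeff n d e (constPoint (v 0)) (constPoint y))
      = jetCoeff n d e (v 0) y := by
    intro s e y; rw [hev]; simp [constPoint]
  have hev2 : ∀ s e j y, evalVec s (jetCoeff n d e (genericPoint v j) (constPoint y))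
      = jetCoeff n d e (linePt v j s) y := by
    intro s e j y; rw [hev]
    congr 1
    funext i c
    simp [genericPoint, linePt, -Polynomial.X_mul_C]
  obtain ⟨T₀, hT₀, hA⟩ := exists_isFlatLimit S (fun t => osculatingSpace (segreVeronese n d) k₁ p ⊔
      ⨆ (j : Fin m) (_ : j ≠ 0), osculatingSpace (segreVeronese n d) k₂ (γ j t)) (by
    intro t
    simp only [osculatingSpace_eq_span hv0 hp, osculatingSpace_eq_span (hne _ _) (hγ _ t)]
    apply le_antisymm
    · refine sup_le (Submodule.span_mono ?_) (iSup_le fun j => iSup_le fun hj =>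
        Submodule.span_mono ?_)
      · rintro _ ⟨e, he, y, rfl⟩
        exact ⟨_, Or.inl ⟨e, he, y, rfl⟩, hev1 _ _ _⟩
      · rintro _ ⟨e, he, y, rfl⟩
        exact ⟨_, Or.inr ⟨j, hj, e, he, y, rfl⟩, hev2 _ _ _ _⟩
    · rw [Submodule.span_le]
      rintro _ ⟨_, ⟨e, he, y, rfl⟩ | ⟨j, hj, e, he, y, rfl⟩, rfl⟩
      · exact Submodule.mem_sup_left (Submodule.subset_span ⟨e, he, y, hev1 _ _ _⟩)
      · refine Submodule.mem_sup_right (Submodule.mem_iSup_of_mem j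
          (Submodule.mem_iSup_of_mem hj (Submodule.subset_span ⟨e, he, y, hev2 _ _ _ _⟩))))
  refine ⟨T₀, hT₀, fun w hw a ha => ?_⟩
  -- The family `A` kills all generators in `S`, so its value `a` at `0` kills the limit.
  obtain ⟨A, hA0, hA1, hA2⟩ := exists_moving_form hv h (ha.vanishesAlongLines hv0 hp)
  simp only [← hA0]
  refine hA A ?_ w hw
  rintro _ (⟨e, he, y, rfl⟩ | ⟨j, hj, e, he, y, rfl⟩)
  · rw [← coeff_contact]
    exact Polynomial.X_pow_dvd_iff.1 (hA1 _) e (by omega)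
  · rw [← coeff_contact]
    exact Polynomial.X_pow_dvd_iff.1 (hA2 j hj _) e (by omega)

end Degeneration

/-! ### Rational normal curves through two points. -/

section Curves

variable {r m : ℕ} {n d : Fin r → ℕ} [NeZero m]

theorem Represents.eq {ι : Type} {v : ι → ℂ} {p q : Projectivization ℂ (ι → ℂ)}
    (h : Represents v p) (h' : Represents v q) : p = q := by
  obtain ⟨_, rfl⟩ := h
  obtain ⟨_, rfl⟩ := h'
  rfl

/-- The linear map sending the moment vectors `(s ^ (D - a) t ^ a)ₐ`, `D = ∑ i, d i`, to the points
`svVec n d (s • v + t • w)`. -/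
noncomputable def momentMap (n d : Fin r → ℕ) (v w : (i : Fin r) → Fin (n i + 1) → ℂ) :
    (Fin (∑ i, d i + 1) → ℂ) →ₗ[ℂ] (SVIndex n d → ℂ) where
  toFun c J := ∑ S : Finset (Σ i, Fin (d i)),
    c ⟨Sᶜ.card, Nat.lt_succ_of_le ((Finset.card_le_univ _).trans_eq (by simp))⟩ *
      ((∏ p ∈ S, v p.1 (rep J p.1 p.2)) * ∏ p ∈ Sᶜ, w p.1 (rep J p.1 p.2))
  map_add' c c' := by funext J; simp [add_mul, Finset.sum_add_distrib]
  map_smul' a c := by funext J; simp [Finset.mul_sum, mul_assoc]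

theorem momentMap_moment (v w : (i : Fin r) → Fin (n i + 1) → ℂ) (s t : ℂ) :
    momentMap n d v w (fun a => s ^ (∑ i, d i - (a : ℕ)) * t ^ (a : ℕ))
      = svVec n d fun i => s • v i + t • w i := by
  funext J
  rw [svVec_eq_svCoord, svCoord_eq, ← Fintype.prod_sigma
    (fun p : (Σ i, Fin (d i)) => (s • v p.1 + t • w p.1) (rep J p.1 p.2))]
  simp only [Pi.add_apply, Pi.smul_apply, smul_eq_mul]
  -- In the expansion, `S` is the set of positions contributing `s • v`, which gives the term `s ^
  -- |S| t ^ |Sᶜ|`.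
  rw [Finset.prod_add, Finset.powerset_univ]
  refine Finset.sum_congr rfl fun S _ => ?_
  have hS : ∑ i, d i - Sᶜ.card = S.card := by
    have := Finset.card_add_card_compl S
    simp only [Fintype.card_sigma, Fintype.card_fin] at this
    omega
  simp only [hS, ← Finset.compl_eq_univ_sdiff, Finset.prod_mul_distrib, Finset.prod_const]
  ring

/-- The product of `a` factors `y` and the remaining factors `x` restricts to `t ^ a` at `v + t w`.
Comparing polynomials in `t`, composing with this form reads off the `a`-th coordinate. -/
theorem momentMap_injective {v w : (i : Fin r) → Fin (n i + 1) → ℂ}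
    {x y : (i : Fin r) → Fin (n i + 1) → ℂ} (hxv : ∀ i, x i ⬝ᵥ v i = 1) (hxw : ∀ i, x i ⬝ᵥ w i = 0)
    (hyv : ∀ i, y i ⬝ᵥ v i = 0) (hyw : ∀ i, y i ⬝ᵥ w i = 1) :
    Function.Injective (momentMap n d v w) := by
  classical
  rw [← LinearMap.ker_eq_bot, LinearMap.ker_eq_bot']
  intro c hc
  funext a
  obtain ⟨E, -, hE⟩ := Finset.exists_subset_card_eq
    (s := (Finset.univ : Finset (Σ i, Fin (d i)))) (n := (a : ℕ))
    (by have := a.isLt; simp only [Finset.card_univ, Fintype.card_sigma, Fintype.card_fin]; omega)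
  let l : (i : Fin r) → Fin (d i) → Fin (n i + 1) → ℂ := fun i k => if ⟨i, k⟩ ∈ E then y i else x i
  let Φ : (Fin (∑ i, d i + 1) → ℂ) →ₗ[ℂ] ℂ :=
    (dotProductBilin ℂ ℂ (prodForm l)) ∘ₗ momentMap n d v w
  have hΦ : ∀ b, Φ b = ∑ J, prodForm l J * momentMap n d v w b J := fun b => rfl
  have hmom : ∀ t : ℂ, Φ (fun a => 1 ^ (∑ i, d i - (a : ℕ)) * t ^ (a : ℕ)) = t ^ (a : ℕ) := by
    intro t
    rw [hΦ, momentMap_moment, prodForm_dot_sigma, ← hE, ← Finset.prod_const,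
      ← Finset.prod_subset (Finset.subset_univ E)]
    · refine Finset.prod_congr rfl fun p hp => ?_
      simp [l, hp, hyv, hyw]
    · intro p _ hp
      simp [l, hp, hxv, hxw]
  have hlin : ∀ b, Φ b = ∑ j, Φ (Pi.single j 1) * b j := by
    intro b
    conv_lhs => rw [← (Pi.basisFun ℂ (Fin (∑ i, d i + 1))).sum_repr b]
    simp [map_sum, mul_comm]
  have hpoly : ∑ j : Fin (∑ i, d i + 1), Polynomial.C (Φ (Pi.single j 1)) * Polynomial.X ^ (j : ℕ)
      = Polynomial.X ^ (a : ℕ) := by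
    apply Polynomial.funext
    intro t
    rw [Polynomial.eval_finsetSum, Polynomial.eval_pow, Polynomial.eval_X, ← hmom t, hlin]
    simp
  have hcoef : ∀ j : Fin (∑ i, d i + 1), Φ (Pi.single j 1) = if j = a then 1 else 0 := by
    intro j
    have := congrArg (fun q => Polynomial.coeff q (j : ℕ)) hpoly
    simpa [Polynomial.finsetSum_coeff, Polynomial.coeff_X_pow, Fin.val_inj] using this
  have h1 := hlin c
  simp only [hcoef, ite_mul, one_mul, zero_mul, Finset.sum_ite_eq', Finset.mem_univ, if_true] at h1
  rw [Pi.zero_apply, ← h1, hΦ, hc]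
  simp

/-- The image in the Segre-Veronese variety of the product embedding of the line through `v` and
`w`. -/
def curveThrough (n d : Fin r → ℕ) (v w : (i : Fin r) → Fin (n i + 1) → ℂ) :
    Set (Projectivization ℂ (SVIndex n d → ℂ)) :=
  {p | ∃ s t : ℂ, (s ≠ 0 ∨ t ≠ 0) ∧ Represents (svVec n d fun i => s • v i + t • w i) p}

theorem isRationalNormalCurve_curveThrough {v w : (i : Fin r) → Fin (n i + 1) → ℂ}
    {x y : (i : Fin r) → Fin (n i + 1) → ℂ} (hxv : ∀ i, x i ⬝ᵥ v i = 1) (hxw : ∀ i, x i ⬝ᵥ w i = 0)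
    (hyv : ∀ i, y i ⬝ᵥ v i = 0) (hyw : ∀ i, y i ⬝ᵥ w i = 1) :
    IsRationalNormalCurve (∑ i, d i) (curveThrough n d v w) := by
  refine ⟨momentMap n d v w, momentMap_injective hxv hxw hyv hyw, ?_⟩
  simp only [momentMap_moment]
  rfl

theorem curveThrough_subset {v w : (i : Fin r) → Fin (n i + 1) → ℂ}
    {x y : (i : Fin r) → Fin (n i + 1) → ℂ} (hxv : ∀ i, x i ⬝ᵥ v i = 1) (hxw : ∀ i, x i ⬝ᵥ w i = 0)
    (hyv : ∀ i, y i ⬝ᵥ v i = 0) (hyw : ∀ i, y i ⬝ᵥ w i = 1) :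
    curveThrough n d v w ⊆ segreVeronese n d := by
  rintro p ⟨s, t, hst, hp⟩
  refine ⟨_, fun i h0 => ?_, hp⟩
  have h1 := congrArg (x i ⬝ᵥ ·) h0
  have h2 := congrArg (y i ⬝ᵥ ·) h0
  simp only [dotProduct_add, dotProduct_smul, hxv, hxw, hyv, hyw, dotProduct_zero, smul_eq_mul,
    mul_one, mul_zero, add_zero, zero_add] at h1 h2
  rcases hst with h | h
  · exact h h1
  · exact h h2

/-- Since `x + y` equals `1` on the whole line, the product with all factors `x + y` forces the
proportionality scalar to be `1`; replacing one factor by `y` then reads off the parameter.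
Positivity of `r` and `d` supplies that factor. -/
theorem linePt_parameter_unique [NeZero r] (hd : ∀ i, 0 < d i)
    {v : Fin m → (i : Fin r) → Fin (n i + 1) → ℂ} {j : Fin m}
    {x y : (i : Fin r) → Fin (n i + 1) → ℂ} (hxv : ∀ i, x i ⬝ᵥ v 0 i = 1)
    (hxw : ∀ i, x i ⬝ᵥ v j i = 0) (hyv : ∀ i, y i ⬝ᵥ v 0 i = 0) (hyw : ∀ i, y i ⬝ᵥ v j i = 1)
    {s s' : ℂ} {p : Projectivization ℂ (SVIndex n d → ℂ)}
    (h : Represents (svVec n d (linePt v j s)) p) (h' : Represents (svVec n d (linePt v j s')) p) :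
    s = s' := by
  classical
  obtain ⟨c, -, hc⟩ := h'.exists_smul h
  have hl : ∀ l : (i : Fin r) → Fin (d i) → Fin (n i + 1) → ℂ,
      ∏ p : (Σ i, Fin (d i)), l p.1 p.2 ⬝ᵥ linePt v j s p.1
        = c * ∏ p : (Σ i, Fin (d i)), l p.1 p.2 ⬝ᵥ linePt v j s' p.1 := by
    intro l
    rw [← prodForm_dot_sigma, ← prodForm_dot_sigma, hc, Finset.mul_sum]
    exact Finset.sum_congr rfl fun J _ => by
      rw [Pi.smul_apply, smul_eq_mul, mul_left_comm]
  have hxy : ∀ t i, (x i + y i) ⬝ᵥ linePt v j t i = 1 := by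
    intro t i
    simp [linePt, add_dotProduct, dotProduct_add, hxv, hxw, hyv, hyw]
  have hy : ∀ t i, y i ⬝ᵥ linePt v j t i = t := by
    intro t i
    simp [linePt, dotProduct_add, hyv, hyw]
  have h1 : c = 1 := by
    have := hl fun i _ => x i + y i
    simpa [hxy] using this.symm
  let p₀ : Σ i, Fin (d i) := ⟨0, ⟨0, hd 0⟩⟩
  have h2 := hl fun i k => if (⟨i, k⟩ : Σ i, Fin (d i)) = p₀ then y i else x i + y i
  have h3 : ∀ t, ∏ p : (Σ i, Fin (d i)),
      (if (⟨p.1, p.2⟩ : Σ i, Fin (d i)) = p₀ then y p.1 else x p.1 + y p.1) ⬝ᵥ linePt v j t p.1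
        = t := by
    intro t
    rw [Finset.prod_eq_single p₀]
    · simp [hy]
    · intro p _ hp
      simp [hp, hxy]
    · simp
  rwa [h3, h3, h1, one_mul] at h2

theorem isMorphism_linePt {v : Fin m → (i : Fin r) → Fin (n i + 1) → ℂ} {j : Fin m}
    {γ : affineLine.Point → Projectivization ℂ (SVIndex n d → ℂ)}
    (hγ : ∀ t, Represents (svVec n d (linePt v j (lineCoord t))) (γ t)) :
    IsMorphism affineLine γ := by
  have heval : ∀ s J, Polynomial.eval s (svCoord n d (genericPoint v j) J)
      = svVec n d (linePt v j s) J := by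
    intro s J
    rw [← Polynomial.coe_evalRingHom, map_svCoord, svVec_eq_svCoord]
    congr 1
    funext i c
    simp [genericPoint, linePt, -Polynomial.X_mul_C]
  have key : ∀ t : affineLine.Point,
      (fun J => t ((svCoord n d (genericPoint v j) J : Polynomial ℂ)))
        = svVec n d (linePt v j (lineCoord t)) := fun t =>
    funext fun J => (point_apply t _).trans (heval _ J)
  intro t
  refine ⟨(svCoord n d (genericPoint v j) : SVIndex n d → Polynomial ℂ), ?_, fun t' _ => ?_⟩
  · rw [key]
    exact (hγ t).1
  · rw [key]
    exact hγ t'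

end Curves

/-! ### General points have independent components. -/

section GeneralPosition

variable {r m : ℕ} {n d : Fin r → ℕ}

/-- The multi-index all of whose entries are `0` but one in the `i`-th factor, which is `c`. -/
def coordIndex (hd : ∀ i, 0 < d i) (hm : ∀ i, m ≤ n i + 1) (i : Fin r) (c : Fin m) : SVIndex n d :=
  OrdIndex.toSV (changeAt (fun _ => 0) (fun i' _ => Fin.castLE (hm i') c) ⟨i, ⟨0, hd i⟩⟩)

/-- The factor `μ` does not depend on `c`, so independence of the `i`-th components can be tested by
determinants in the ambient homogeneous coordinates. -/
theorem exists_svVec_coordIndex (hd : ∀ i, 0 < d i) (hm : ∀ i, m ≤ n i + 1) (i : Fin r)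
    (v : (i : Fin r) → Fin (n i + 1) → ℂ) :
    ∃ μ : ℂ, ((∀ i, v i 0 = 1) → μ = 1) ∧
      ∀ c, svVec n d v (coordIndex hd hm i c) = μ * v i (Fin.castLE (hm i) c) := by
  classical
  refine ⟨∏ p ∈ Finset.univ.erase (⟨i, ⟨0, hd i⟩⟩ : Σ i, Fin (d i)), v p.1 0, fun h => by simp [h],
    fun c => ?_⟩
  rw [svVec_eq_svCoord, coordIndex, svCoord_toSV, ← Fintype.prod_sigma (fun p : (Σ i, Fin (d i)) =>
      v p.1 (changeAt (fun _ => 0) (fun i' _ => Fin.castLE (hm i') c) ⟨i, ⟨0, hd i⟩⟩ p.1 p.2)),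
    ← Finset.mul_prod_erase _ _ (Finset.mem_univ (⟨i, ⟨0, hd i⟩⟩ : Σ i, Fin (d i))), mul_comm]
  congr 1
  · refine Finset.prod_congr rfl fun p hp => ?_
    have := Finset.ne_of_mem_erase hp
    simp [changeAt, this]
  · simp [changeAt]

/-- General points of a Segre-Veronese variety have linearly independent components. -/
theorem forGeneralPoints_of_linearIndependent (hd : ∀ i, 0 < d i) (hm : ∀ i, m ≤ n i + 1)
    {P : (Fin m → Projectivization ℂ (SVIndex n d → ℂ)) → Prop}
    (hP : ∀ (p : Fin m → Projectivization ℂ (SVIndex n d → ℂ))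
      (v : Fin m → (i : Fin r) → Fin (n i + 1) → ℂ), (∀ j, Represents (svVec n d (v j)) (p j)) →
      (∀ i, LinearIndependent ℂ fun j => v j i) → P p) :
    ForGeneralPoints (segreVeronese n d) m P := by
  let N : Fin r → Matrix (Fin m) (Fin m) (MvPolynomial (Fin m × SVIndex n d) ℂ) := fun i =>
    Matrix.of fun j c => MvPolynomial.X (j, coordIndex hd hm i c)
  have heval : ∀ w : Fin m → SVIndex n d → ℂ,
      MvPolynomial.eval (fun x => w x.1 x.2) (∏ i, (N i).det)
        = ∏ i, (Matrix.of fun j c => w j (coordIndex hd hm i c)).det := by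
    intro w
    rw [map_prod]
    refine Finset.prod_congr rfl fun i _ => ?_
    rw [RingHom.map_det]
    congr 1
    ext j c
    simp [N]
  -- Points of a moment curve with distinct nodes `0, …, m - 1` give Vandermonde determinants; their
  -- zeroth entries are `1` (with `0 ^ 0 = 1`), so `μ = 1`.
  refine ⟨∏ i, (N i).det, ⟨fun j => svVec n d fun i c => ((j : ℕ) : ℂ) ^ (c : ℕ), fun j => ?_, ?_⟩,
    ?_⟩
  · beta_reduce
    rw [← one_smul ℂ (svVec n d _)]
    refine represents_svVec_mem (fun i h0 => ?_) one_ne_zero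
    have := congrFun h0 0
    simp at this
  · refine (heval fun j => svVec n d fun i c => ((j : ℕ) : ℂ) ^ (c : ℕ)).trans_ne ?_
    rw [Finset.prod_ne_zero_iff]
    intro i _
    have : (Matrix.of fun (j c : Fin m) => svVec n d (fun i c => ((j : ℕ) : ℂ) ^ (c : ℕ))
        (coordIndex hd hm i c)) = Matrix.vandermonde fun j : Fin m => ((j : ℕ) : ℂ) := by
      ext j c
      obtain ⟨μ, hμ, h⟩ := exists_svVec_coordIndex hd hm i
        (fun i (c : Fin (n i + 1)) => ((j : ℕ) : ℂ) ^ (c : ℕ))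
      rw [Matrix.of_apply, h, hμ (fun i => by simp), one_mul]
      simp
    rw [this, Matrix.det_vandermonde_ne_zero_iff]
    intro j j' h
    exact Fin.ext (Nat.cast_injective h)
  · intro p w hp hw hF
    choose v hv hvp using hp
    refine hP p v hvp fun i => ?_
    choose c hc hwc using fun j => (hvp j).exists_smul (hw j)
    choose μ _ hμ' using fun j => exists_svVec_coordIndex hd hm i (v j)
    rw [heval, Finset.prod_ne_zero_iff] at hF
    have hdet := hF i (Finset.mem_univ i)
    -- Up to a scalar per row, this is the matrix of the first `m` coordinates of the components,
    -- whose independence implies that of the full vectors.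
    have : (Matrix.of fun j c => w j (coordIndex hd hm i c))
        = Matrix.of fun j c' => (c j * μ j) * (Matrix.of fun j c' => v j i (Fin.castLE (hm i) c')) j c' := by
      ext j c'
      simp only [Matrix.of_apply, hwc j, Pi.smul_apply, smul_eq_mul, hμ' j, mul_assoc]
    rw [this, Matrix.det_mul_column] at hdet
    have hli := Matrix.linearIndependent_rows_of_det_ne_zero (right_ne_zero_of_mul hdet)
    exact LinearIndependent.of_comp (LinearMap.funLeft ℂ ℂ (Fin.castLE (hm i))) hli

end GeneralPosition

/-! ### Assembling the two regularity statements. -/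

section Main

variable {r m : ℕ} {n d : Fin r → ℕ} [NeZero m] [NeZero r]

/-- Points with linearly independent components can be joined by rational normal curves along
which the spans of osculating spaces degenerate well. -/
theorem exists_degeneration (hd : ∀ i, 0 < d i) {p : Fin m → Projectivization ℂ (SVIndex n d → ℂ)}
    {v : Fin m → (i : Fin r) → Fin (n i + 1) → ℂ} (hp : ∀ j, Represents (svVec n d (v j)) (p j))
    (hv : ∀ i, LinearIndependent ℂ fun j => v j i) :
    ∃ (R : Fin m → Set (Projectivization ℂ (SVIndex n d → ℂ)))
      (γ : Fin m → affineLine.Point → Projectivization ℂ (SVIndex n d → ℂ)),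
      (∀ j, j ≠ 0 →
        IsRationalNormalCurve (∑ i, d i) (R j) ∧ R j ⊆ segreVeronese n d ∧
        IsMorphism affineLine (γ j) ∧ Function.Injective (γ j) ∧ (∀ t, γ j t ∈ R j) ∧
        γ j (linePoint 0) = p 0 ∧ γ j (linePoint 1) = p j) ∧
      ∀ k₁ k₂ : ℕ, k₂ ≤ k₁ ∨ m ≤ 2 → ∃ T₀ : Submodule ℂ (SVIndex n d → ℂ),
        IsFlatLimit affineLine (linePoint 0) (fun t => osculatingSpace (segreVeronese n d) k₁ (p 0) ⊔
          ⨆ (j : Fin m) (_ : j ≠ 0), osculatingSpace (segreVeronese n d) k₂ (γ j t)) T₀ ∧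
        T₀ ≤ osculatingSpace (segreVeronese n d) (k₁ + k₂ + 1) (p 0) := by
  choose σ x hσ hxv _ using fun i => exists_dual_coordinates (hv i)
  -- For `j = 0` the line is constant; otherwise the sum of the two dual coordinates is `1` along
  -- it.
  have hne : ∀ j s i, linePt v j s i ≠ 0 := by
    intro j s i h0
    by_cases hj : j = 0
    · subst hj
      refine (hv i).ne_zero 0 (Eq.trans ?_ h0)
      simp only [linePt]
      rw [← add_smul, sub_add_cancel, one_smul]
    · have h2 : σ i j ≠ σ i 0 := fun h => hj (hσ i h)
      have h1 := congrArg ((x i (σ i 0) + x i (σ i j)) ⬝ᵥ ·) h0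
      simp [linePt, add_dotProduct, dotProduct_add, hxv, h2, Ne.symm h2] at h1
  let γ : Fin m → affineLine.Point → Projectivization ℂ (SVIndex n d → ℂ) := fun j t =>
    Projectivization.mk ℂ (svVec n d (linePt v j (lineCoord t))) (svVec_ne_zero (hne j _))
  have hγ : ∀ j t, Represents (svVec n d (linePt v j (lineCoord t))) (γ j t) := fun j t => ⟨_, rfl⟩
  refine ⟨fun j => curveThrough n d (v 0) (v j), γ, fun j hj => ?_, fun k₁ k₂ h =>
    exists_isFlatLimit_osculating hv h (hp 0) hγ hne⟩
  have h1 : ∀ i, x i (σ i 0) ⬝ᵥ v 0 i = 1 := fun i => by simp [hxv]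
  have h2 : ∀ i, x i (σ i 0) ⬝ᵥ v j i = 0 := fun i => by
    rw [hxv, if_neg fun h => hj (hσ i h).symm]
  have h3 : ∀ i, x i (σ i j) ⬝ᵥ v 0 i = 0 := fun i => by
    rw [hxv, if_neg fun h => hj (hσ i h)]
  have h4 : ∀ i, x i (σ i j) ⬝ᵥ v j i = 1 := fun i => by simp [hxv]
  refine ⟨isRationalNormalCurve_curveThrough h1 h2 h3 h4, curveThrough_subset h1 h2 h3 h4,
    isMorphism_linePt (hγ j), ?_, ?_, ?_, ?_⟩
  · intro t t' htt
    exact lineCoord_injective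
      (linePt_parameter_unique hd h1 h2 h3 h4 (hγ j t) (htt ▸ hγ j t'))
  · intro t
    refine ⟨1 - lineCoord t, lineCoord t, ?_, hγ j t⟩
    by_contra! h
    rw [h.2] at h
    simp at h
  · refine (hγ j _).eq ?_
    rw [lineCoord_linePoint]
    convert hp 0 using 2
    funext i
    simp [linePt]
  · refine (hγ j _).eq ?_
    rw [lineCoord_linePoint]
    convert hp j using 2
    funext i
    simp [linePt]

theorem iSup_fin_two {α : Type*} [CompleteLattice α] (f : Fin 2 → α) :
    ⨆ (j : Fin 2) (_ : j ≠ 0), f j = f 1 := by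
  apply le_antisymm
  · refine iSup_le fun j => iSup_le fun hj => ?_
    rw [show j = 1 by omega]
  · exact le_iSup₂_of_le 1 (by decide) le_rfl

end Main

end OscReg

theorem mainTheorem11 (r : ℕ) [NeZero r] (n d : Fin r → ℕ)
    (hn : ∀ i, 0 < n i) (hd : ∀ i, 0 < d i) (hmono : Monotone n) :
    OscReg.HasStrongTwoOsculatingRegularity (OscReg.segreVeronese n d) ∧
    OscReg.HasOsculatingRegularity (OscReg.segreVeronese n d) (n 0 + 1) ∧
    -- the degenerations can be taken along rational normal curves of degree `∑ i, d i`
    OscReg.ForGeneralPoints (OscReg.segreVeronese n d) 2 (fun p =>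
      ∃ (R : Set (Projectivization ℂ (OscReg.SVIndex n d → ℂ)))
        (C : OscReg.SmoothCurve) (t₀ tinf : C.Point)
        (γ : C.Point → Projectivization ℂ (OscReg.SVIndex n d → ℂ)),
        OscReg.IsRationalNormalCurve (∑ i, d i) R ∧ R ⊆ OscReg.segreVeronese n d ∧
        OscReg.IsMorphism C γ ∧ Function.Injective γ ∧ (∀ t, γ t ∈ R) ∧
        γ t₀ = p 0 ∧ γ tinf = p 1 ∧
        ∀ k₁ k₂ : ℕ,
          OscReg.PairLimitContained (OscReg.segreVeronese n d) (p 0) C t₀ γ k₁ k₂) ∧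
    OscReg.ForGeneralPoints (OscReg.segreVeronese n d) (n 0 + 1) (fun p =>
      ∃ (R : Fin (n 0 + 1) → Set (Projectivization ℂ (OscReg.SVIndex n d → ℂ)))
        (C : OscReg.SmoothCurve) (t₀ tinf : C.Point)
        (γ : Fin (n 0 + 1) → C.Point → Projectivization ℂ (OscReg.SVIndex n d → ℂ)),
        (∀ j, j ≠ 0 →
          OscReg.IsRationalNormalCurve (∑ i, d i) (R j) ∧ R j ⊆ OscReg.segreVeronese n d ∧
          OscReg.IsMorphism C (γ j) ∧ Function.Injective (γ j) ∧ (∀ t, γ j t ∈ R j) ∧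
          γ j t₀ = p 0 ∧ γ j tinf = p j) ∧
        ∀ k : ℕ, OscReg.MultiLimitContained (OscReg.segreVeronese n d) (p 0) C t₀ γ k) := by

  have hpair : OscReg.ForGeneralPoints (OscReg.segreVeronese n d) 2 (fun p =>
      ∃ (R : Set (Projectivization ℂ (OscReg.SVIndex n d → ℂ)))
        (C : OscReg.SmoothCurve) (t₀ tinf : C.Point)
        (γ : C.Point → Projectivization ℂ (OscReg.SVIndex n d → ℂ)),
        OscReg.IsRationalNormalCurve (∑ i, d i) R ∧ R ⊆ OscReg.segreVeronese n d ∧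
        OscReg.IsMorphism C γ ∧ Function.Injective γ ∧ (∀ t, γ t ∈ R) ∧
        γ t₀ = p 0 ∧ γ tinf = p 1 ∧
        ∀ k₁ k₂ : ℕ,
          OscReg.PairLimitContained (OscReg.segreVeronese n d) (p 0) C t₀ γ k₁ k₂) := by
    refine OscReg.forGeneralPoints_of_linearIndependent hd
      (fun i => Nat.succ_le_succ (hn i)) fun p v hp hv => ?_
    obtain ⟨R, γ, h, hlim⟩ := OscReg.exists_degeneration hd hp hv
    obtain ⟨h1, h2, h3, h4, h5, h6, h7⟩ := h 1 (by decide)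
    refine ⟨R 1, OscReg.affineLine, OscReg.linePoint 0, OscReg.linePoint 1, γ 1,
      h1, h2, h3, h4, h5, h6, h7, fun k₁ k₂ => ?_⟩
    -- With only two points there is a single moving point, so the orders need not be comparable.
    have := hlim k₁ k₂ (Or.inr le_rfl)
    simp only [OscReg.iSup_fin_two] at this
    exact this
  have hmulti : OscReg.ForGeneralPoints (OscReg.segreVeronese n d) (n 0 + 1) (fun p =>
      ∃ (R : Fin (n 0 + 1) → Set (Projectivization ℂ (OscReg.SVIndex n d → ℂ)))
        (C : OscReg.SmoothCurve) (t₀ tinf : C.Point)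
        (γ : Fin (n 0 + 1) → C.Point → Projectivization ℂ (OscReg.SVIndex n d → ℂ)),
        (∀ j, j ≠ 0 →
          OscReg.IsRationalNormalCurve (∑ i, d i) (R j) ∧ R j ⊆ OscReg.segreVeronese n d ∧
          OscReg.IsMorphism C (γ j) ∧ Function.Injective (γ j) ∧ (∀ t, γ j t ∈ R j) ∧
          γ j t₀ = p 0 ∧ γ j tinf = p j) ∧
        ∀ k : ℕ, OscReg.MultiLimitContained (OscReg.segreVeronese n d) (p 0) C t₀ γ k) := by
    -- Monotonicity makes `n 0` the smallest dimension, so every factor has room for `n 0 + 1`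
    -- independent vectors.
    refine OscReg.forGeneralPoints_of_linearIndependent hd
      (fun i => Nat.succ_le_succ (hmono (Fin.zero_le i))) fun p v hp hv => ?_
    obtain ⟨R, γ, h, hlim⟩ := OscReg.exists_degeneration hd hp hv
    refine ⟨R, OscReg.affineLine, OscReg.linePoint 0, OscReg.linePoint 1, γ, h, fun k => ?_⟩
    have := hlim k k (Or.inl le_rfl)
    rw [← two_mul] at this
    exact this
  refine ⟨?_, ?_, hpair, hmulti⟩
  · obtain ⟨F, hF, h⟩ := hpair
    refine ⟨F, hF, fun p w hp hw hFw k₁ k₂ => ?_⟩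
    obtain ⟨R, C, t₀, tinf, γ, -, h2, h3, -, h5, h6, h7, h8⟩ := h p w hp hw hFw
    exact ⟨C, t₀, tinf, γ, h3, fun t => h2 (h5 t), h6, h7, h8 k₁ k₂⟩
  · obtain ⟨F, hF, h⟩ := hmulti
    refine ⟨F, hF, fun p w hp hw hFw k => ?_⟩
    obtain ⟨R, C, t₀, tinf, γ, h1, h2⟩ := h p w hp hw hFw
    refine ⟨C, t₀, tinf, γ, fun j hj => ?_, h2 k⟩
    obtain ⟨-, g2, g3, -, g5, g6, g7⟩ := h1 j hj
    exact ⟨g3, fun t => g2 (g5 t), g6, g7⟩
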